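/- **Proposition.** Let $V\subset V'$ be an immediate extension of valuation rings with fraction fields $K\subset K'$, that is, the inclusion is local and induces isomorphisms between the value groups and between the residue fields of $V$ and $V'$. Assume that $K'=K(x)$ for some $x\in K'$ algebraic over $K$. Then $V'$ is a filtered union of complete intersection $V$-subalgebras: there is a nonempty family $\mathcal S$ of $V$-subalgebras of $V'$, directed under inclusion and with union $V'$, such that every member of $\mathcal S$ is a complete intersection $V$-algebra. Here a $V$-algebra is called a *complete intersection* if it is isomorphic over $V$ to $T_h/(P)$, where $T=V[X_1,\dots,X_n]$ is a polynomial ring in finitely many variables, $0\neq h\in T$, and $P=(P_1,\dots,P_r)$ is a finite regular sequence in $T_h$ (in particular $T_h/(P)\neq 0$; $n=0$ and $r=0$ are allowed). Flatness over $V$ is not part of the definition. -/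

import Mathlib

/-- `V ⊆ V'` is an extension of valuation rings with fraction fields `K ⊆ K'`. It is immediate if
it is local and the induced maps on value groups and on residue fields are isomorphisms.
(Mathlib's `ValuationRing.ValueGroup` is the value group written multiplicatively, with a zero
adjoined; the map induced by the extension is the one compatible with the valuations.) -/
structure IsImmediateExtension (V K V' K' : Type*)
    [CommRing V] [IsDomain V] [ValuationRing V] [Field K] [Algebra V K] [IsFractionRing V K]
    [CommRing V'] [IsDomain V'] [ValuationRing V'] [Field K'] [Algebra V' K']
    [IsFractionRing V' K'] [Algebra V V'] [Algebra K K'] : Prop where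
  injective : Function.Injective (algebraMap V V')
  isLocalHom : IsLocalHom (algebraMap V V')
  valueGroup : ∃ e : ValuationRing.ValueGroup V K ≃*o ValuationRing.ValueGroup V' K',
    ∀ a : K, e (ValuationRing.valuation V K a) =
      ValuationRing.valuation V' K' (algebraMap K K' a)
  residueField : Function.Bijective (IsLocalRing.ResidueField.map (algebraMap V V'))

/-- A complete intersection `A`-algebra: an `A`-algebra isomorphic to `T_h / (P)`, where `T` is a
polynomial `A`-algebra in finitely many variables, `0 ≠ h ∈ T`, and `P` is a (finite) regular
sequence of elements of `T_h`. Flatness over `A` is not required. -/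
def IsCompleteIntersectionAlgebra (A B : Type*) [CommRing A] [CommRing B] [Algebra A B] : Prop :=
  ∃ (n : ℕ) (h : MvPolynomial (Fin n) A) (P : List (Localization.Away h)),
    h ≠ 0 ∧ RingTheory.Sequence.IsRegular (Localization.Away h) P ∧
      Nonempty ((Localization.Away h ⧸ Ideal.ofList P) ≃ₐ[A] B)

/-- `B` is the filtered union of a family of `A`-subalgebras, each having the property `Q`. -/
def IsFilteredUnionOf (A B : Type*) [CommRing A] [CommRing B] [Algebra A B]
    (Q : Subalgebra A B → Prop) : Prop :=
  ∃ S : Set (Subalgebra A B), S.Nonempty ∧ DirectedOn (· ≤ ·) S ∧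
    (∀ C ∈ S, Q C) ∧ ∀ b : B, ∃ C ∈ S, b ∈ C

open Polynomial RingTheory.Sequence

/-! Rescale `x` so that `v x ≤ 1`, let `f` be its minimal polynomial over `K`, and work in the local
domain `O = K[X]_(f)`, with residue map `ev : O → K'`. The target subalgebras are images under `ev`
of charts: complete intersection `V`-subalgebras of `O` on which `ev` has integral values. They are
built from `V[X]` by adjoining quotients `Q/b` and by inverting elements of value `1`.

The charts come from an induction on `m` (`HasCharts.succ`). For finitely many given polynomials, a
chart is wanted in which those of degree less than `m` become scalars times units, while all nonzero
ones stay scalars times elements regular over `V`. Immediacy gives a monic `Q` of degree `m` whose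
value at `x` is smaller than that of each given polynomial of degree `m` made monic. If `b` in `K`
has the value of `Q(x)`, adjoin `Q/b`. A monic `g` from the list is `(g - Q) + Q`, where `g - Q` has
degree less than `m` and dominates `Q`; hence `g` is a scalar times an element of value `1`, which
can be inverted.

Two facts make this work. If `q` is regular over `V`, then `C[q/β] = C[Y]/(q - βY)`, so the complete
intersection property survives. Modulo `β` this ring is a polynomial ring over `C/(β, q)`, and a
`Q`-adic expansion, divided by its dominant coefficient, has a unit coefficient there; hence
regularity survives (`IsRegularOver.adjoinElem`).

At `m = deg f`, `f` is a scalar times a regular `r` which generates the kernel of `ev` on the chart,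
so the image is again a complete intersection. Each element of `K'` is `p(x)` with `deg p < deg f`,
hence a scalar times a unit of the image; if it is integral, so is the scalar, and it lies in the
image. -/

/-! ### Permanence properties of complete intersection algebras. -/

theorem Ideal.map_symm_ker_algEquiv {A B R R₀ : Type*} [CommRing A] [CommRing B] [CommRing R]
    [CommRing R₀] [Algebra A B] [Algebra A R] [Algebra A R₀] (e : R₀ ≃ₐ[A] R) (φ : R →ₐ[A] B)
    {P : List R} (hker : RingHom.ker φ = Ideal.ofList P) :
    RingHom.ker (φ.comp e.toAlgHom) = Ideal.ofList (P.map e.symm) := by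
  have h1 : Ideal.ofList (P.map e.symm) = (Ideal.ofList P).map (e.symm : R →+* R₀) := by
    rw [Ideal.map_ofList]; rfl
  rw [h1, ← hker]
  apply le_antisymm
  · intro z hz
    have : e.symm (e z) ∈ Ideal.map (e.symm : R →+* R₀) (RingHom.ker φ) :=
      Ideal.mem_map_of_mem (e.symm : R →+* R₀) (show e z ∈ RingHom.ker φ from hz)
    rwa [e.symm_apply_apply] at this
  · rw [Ideal.map_le_iff_le_comap]
    intro w hw
    change φ (e (e.symm w)) = 0
    rwa [e.apply_symm_apply]

theorem RingTheory.Sequence.IsWeaklyRegular.map_algEquiv {A R R₀ : Type*} [CommRing A]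
    [CommRing R] [CommRing R₀] [Algebra A R] [Algebra A R₀] (e : R ≃ₐ[A] R₀)
    {P : List R} (hP : IsWeaklyRegular R P) : IsWeaklyRegular R₀ (P.map e) := by
  refine (AddEquiv.isWeaklyRegular_congr (e := e.toRingEquiv.toAddEquiv) ?_).mp hP
  rw [List.forall₂_map_right_iff]
  exact List.forall₂_same.mpr fun r _ x => map_mul e r x

/-- A presentation of a complete intersection algebra that does not insist on a particular model
of the localized polynomial ring. -/
theorem IsCompleteIntersectionAlgebra.of_surjective {A B R : Type*} [CommRing A] [CommRing B]
    [Algebra A B] [CommRing R] [Algebra A R] [Nontrivial B] {n : ℕ}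
    {h : MvPolynomial (Fin n) A} (e : Localization.Away h ≃ₐ[A] R) (P : List R)
    (hP : IsWeaklyRegular R P) (φ : R →ₐ[A] B) (hφ : Function.Surjective φ)
    (hker : RingHom.ker φ = Ideal.ofList P) : IsCompleteIntersectionAlgebra A B := by
  have hψ : Function.Surjective (φ.comp e.toAlgHom) := hφ.comp e.surjective
  have hk := Ideal.map_symm_ker_algEquiv e φ hker
  refine ⟨n, h, P.map e.symm, ?_, ⟨hP.map_algEquiv e.symm, ?_⟩, ⟨?_⟩⟩
  -- Inverting `0` gives the zero ring, which cannot surject onto the nontrivial `B`.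
  · rintro rfl
    have : Subsingleton (Localization.Away (0 : MvPolynomial (Fin n) A)) :=
      IsLocalization.subsingleton (M := Submonoid.powers (0 : MvPolynomial (Fin n) A))
        (Submonoid.mem_powers 0)
    have := hψ.subsingleton
    exact not_subsingleton B this
  · rw [← hk, smul_eq_mul, Ideal.mul_top]
    exact (RingHom.ker_ne_top (φ.comp e.toAlgHom)).symm
  · exact (Ideal.quotientEquivAlgOfEq A hk.symm).trans (Ideal.quotientKerAlgEquivOfSurjective hψ)

theorem IsCompleteIntersectionAlgebra.exists_surjective {A B : Type*} [CommRing A] [CommRing B]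
    [Algebra A B] (hB : IsCompleteIntersectionAlgebra A B) :
    ∃ (n : ℕ) (h : MvPolynomial (Fin n) A) (P : List (Localization.Away h))
      (φ : Localization.Away h →ₐ[A] B), IsWeaklyRegular (Localization.Away h) P ∧
      Function.Surjective φ ∧ RingHom.ker φ = Ideal.ofList P ∧ Nontrivial B := by
  obtain ⟨n, h, P, -, hP, ⟨e⟩⟩ := hB
  refine ⟨n, h, P, e.toAlgHom.comp (Ideal.Quotient.mkₐ A _), hP.1,
    e.surjective.comp Ideal.Quotient.mk_surjective, ?_, ?_⟩
  · ext z
    rw [RingHom.mem_ker]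
    change e (Ideal.Quotient.mk _ z) = 0 ↔ _
    rw [map_eq_zero_iff _ e.injective, Ideal.Quotient.eq_zero_iff_mem]
  · have h1 := hP.2
    rw [smul_eq_mul, Ideal.mul_top] at h1
    have : Nontrivial (Localization.Away h ⧸ Ideal.ofList P) :=
      Ideal.Quotient.nontrivial_iff.mpr h1.symm
    exact e.injective.nontrivial

theorem IsCompleteIntersectionAlgebra.of_algEquiv {A B D : Type*} [CommRing A] [CommRing B]
    [Algebra A B] [CommRing D] [Algebra A D] (hB : IsCompleteIntersectionAlgebra A B)
    (e : B ≃ₐ[A] D) : IsCompleteIntersectionAlgebra A D := by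
  obtain ⟨n, h, P, h0, hP, ⟨e'⟩⟩ := hB
  exact ⟨n, h, P, h0, hP, ⟨e'.trans e⟩⟩

/-- Dividing a complete intersection algebra by a nonzerodivisor. -/
theorem IsCompleteIntersectionAlgebra.quotient {A B D : Type*} [CommRing A] [CommRing B]
    [Algebra A B] [CommRing D] [Algebra A D] [Nontrivial D]
    (hB : IsCompleteIntersectionAlgebra A B) (φ : B →ₐ[A] D) (hφ : Function.Surjective φ)
    (r : B) (hr : ∀ z, r * z = 0 → z = 0) (hker : ∀ z, φ z = 0 → r ∣ z) (hr0 : φ r = 0) :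
    IsCompleteIntersectionAlgebra A D := by
  obtain ⟨n, h, P, ψ, hP, hψ, hk, -⟩ := hB.exists_surjective
  obtain ⟨p, rfl⟩ := hψ r
  -- The extra relation is a lift `p` of `r`; it is regular modulo `P` because that quotient is `B`.
  refine .of_surjective (AlgEquiv.refl (R := A) (A₁ := Localization.Away h)) (P ++ [p]) ?_
    (φ.comp ψ) (hφ.comp hψ) ?_
  · rw [isWeaklyRegular_append_iff, isWeaklyRegular_singleton_iff]
    refine ⟨hP, ?_⟩
    rw [isSMulRegular_iff_right_eq_zero_of_smul]
    intro z
    obtain ⟨z, rfl⟩ := Submodule.Quotient.mk_surjective _ z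
    rw [← Submodule.Quotient.mk_smul, Submodule.Quotient.mk_eq_zero,
      Submodule.Quotient.mk_eq_zero, smul_eq_mul, smul_eq_mul, Ideal.mul_top, ← hk,
      RingHom.mem_ker, RingHom.mem_ker, map_mul]
    exact hr _
  · rw [Ideal.ofList_append, Ideal.ofList_singleton, ← hk]
    apply le_antisymm
    · intro z hz
      obtain ⟨w, hw⟩ := hker (ψ z) hz
      obtain ⟨w, rfl⟩ := hψ w
      have h1 : z - p * w ∈ RingHom.ker ψ := by
        rw [RingHom.mem_ker, map_sub, map_mul, hw, sub_self]
      have h2 : z = (z - p * w) + p * w := by ring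
      rw [h2]
      exact Ideal.add_mem _ (Ideal.mem_sup_left h1)
        (Ideal.mem_sup_right (Ideal.mul_mem_right _ _ (Ideal.mem_span_singleton_self p)))
    · refine sup_le (fun z hz => ?_) ((Ideal.span_singleton_le_iff_mem _).mpr hr0)
      change φ (ψ z) = 0
      rw [show ψ z = 0 from hz, map_zero]

/-- Localization is exact, so a presentation of `B` localizes to one of `D`, which the hypotheses
make the localization of `B` at the image of `t`. -/
theorem exists_surjective_away {A B D R : Type*} [CommRing A] [CommRing B]
    [Algebra A B] [CommRing D] [Algebra A D] [CommRing R] [Algebra A R]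
    (R' : Type*) [CommRing R'] [Algebra R R'] [Algebra A R'] [IsScalarTower A R R']
    (t : R) [IsLocalization.Away t R'] (ψ : R →ₐ[A] B) (hψ : Function.Surjective ψ)
    (φ : B →ₐ[A] D) (hφ : Function.Injective φ) (htu : IsUnit (φ (ψ t)))
    (hsurj : ∀ z : D, ∃ (k : ℕ) (b : B), φ (ψ t) ^ k * z = φ b) :
    ∃ Θ : R' →ₐ[A] D, Function.Surjective Θ ∧
      RingHom.ker Θ = (RingHom.ker ψ).map (algebraMap R R') := by
  let θ : R' →+* D := IsLocalization.Away.lift (g := (φ.comp ψ).toRingHom) t htu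
  have hθ : ∀ z, θ (algebraMap R R' z) = φ (ψ z) := fun z =>
    IsLocalization.Away.lift_eq (g := (φ.comp ψ).toRingHom) t htu z
  let Θ : R' →ₐ[A] D := { θ with
    commutes' := fun a => by
      change θ (algebraMap A R' a) = _
      rw [IsScalarTower.algebraMap_apply A R R', hθ, AlgHom.commutes, AlgHom.commutes] }
  refine ⟨Θ, fun z => ?_, le_antisymm (fun z hz => ?_) ?_⟩
  · obtain ⟨k, b, hb⟩ := hsurj z
    obtain ⟨b, rfl⟩ := hψ b
    obtain ⟨u, hu⟩ := (IsLocalization.Away.algebraMap_isUnit (S := R') t).pow k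
    refine ⟨algebraMap R R' b * (↑u⁻¹ : R'), ?_⟩
    apply (htu.pow k).mul_left_cancel
    have h2 : φ (ψ t) ^ k = Θ u := by
      rw [hu, map_pow]
      change _ = θ _ ^ k
      rw [hθ]
    rw [hb, h2, map_mul, mul_left_comm, ← map_mul, Units.mul_inv, map_one, mul_one]
    exact hθ b
  · obtain ⟨k, w, hw⟩ := IsLocalization.Away.surj t z
    have h1 : φ (ψ w) = 0 := by
      rw [← hθ, ← hw, map_mul, show θ z = 0 from hz, zero_mul]
    have h2 : ψ w = 0 := by rwa [map_eq_zero_iff _ hφ] at h1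
    have h3 : algebraMap R R' w ∈ Ideal.map (algebraMap R R') (RingHom.ker ψ) :=
      Ideal.mem_map_of_mem _ h2
    rw [← hw] at h3
    exact (Ideal.mul_unit_mem_iff_mem _
      ((IsLocalization.Away.algebraMap_isUnit t).pow k)).mp h3
  · rw [Ideal.map_le_iff_le_comap]
    intro w hw
    change θ _ = 0
    rw [hθ, show ψ w = 0 from hw, map_zero]

/-- Localizing a complete intersection algebra at one element. -/
theorem IsCompleteIntersectionAlgebra.away {A B D : Type*} [CommRing A] [CommRing B]
    [Algebra A B] [CommRing D] [Algebra A D] [Nontrivial D]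
    (hB : IsCompleteIntersectionAlgebra A B) (φ : B →ₐ[A] D) (hφ : Function.Injective φ)
    (g : B) (hg : IsUnit (φ g)) (hsurj : ∀ z : D, ∃ (k : ℕ) (b : B), φ g ^ k * z = φ b) :
    IsCompleteIntersectionAlgebra A D := by
  obtain ⟨n, h, P, ψ, hP, hψ, hk, -⟩ := hB.exists_surjective
  obtain ⟨p, hp⟩ := hψ g
  -- The lift of `g` is `t / h^l`. Since `h` is already a unit, inverting `g` amounts to inverting
  -- `t`, and the new localized polynomial ring is that at `h * t`.
  obtain ⟨⟨t, ⟨_, l, rfl⟩⟩, ht⟩ := IsLocalization.surj (Submonoid.powers h) p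
  let t' := algebraMap _ (Localization.Away h) t
  have hhu : IsUnit (algebraMap _ (Localization.Away h) (h ^ l)) := by
    rw [map_pow]; exact (IsLocalization.Away.algebraMap_isUnit h).pow l
  have htg : ψ t' = g * ψ (algebraMap _ (Localization.Away h) (h ^ l)) := by
    rw [← hp, ← map_mul]; exact congrArg ψ ht.symm
  have : IsLocalization.Away (h * t) (Localization.Away t') :=
    IsLocalization.Away.mul' (Localization.Away h) (Localization.Away t') h t
  let e : Localization.Away (h * t) ≃ₐ[A] Localization.Away t' :=
    (IsLocalization.algEquiv (Submonoid.powers (h * t)) (Localization.Away (h * t))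
      (Localization.Away t')).restrictScalars A
  obtain ⟨Θ, hΘ, hΘk⟩ := exists_surjective_away (Localization.Away t') t' ψ hψ φ hφ
    (by rw [htg, map_mul]; exact hg.mul ((hhu.map ψ).map φ)) (fun z => by
      obtain ⟨k, b, hb⟩ := hsurj z
      refine ⟨k, ψ (algebraMap _ (Localization.Away h) (h ^ l)) ^ k * b, ?_⟩
      rw [htg, map_mul, map_mul, ← hb, mul_pow, map_pow φ]
      ring)
  refine .of_surjective e (P.map (algebraMap _ (Localization.Away t')))
    (hP.of_isLocalization (Localization.Away t') (Submonoid.powers t')) Θ hΘ ?_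
  rw [← Ideal.map_ofList, ← hk, hΘk]

theorem isLocalizationAway_polynomial_finSuccEquiv {A : Type*} [CommRing A] {n : ℕ}
    (h : MvPolynomial (Fin n) A) :
    ∃ h' : MvPolynomial (Fin (n + 1)) A,
      Nonempty (Localization.Away h' ≃ₐ[A] (Localization.Away h)[X]) := by
  let T := MvPolynomial (Fin n) A
  let E := MvPolynomial.finSuccEquiv A n
  let R := Localization.Away h
  let : Algebra T[X] R[X] := Polynomial.algebra T R
  have h1 : IsLocalization (Submonoid.map (C : T →+* T[X]) (Submonoid.powers h)) R[X] :=
    Polynomial.isLocalization _ _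
  let : Algebra (MvPolynomial (Fin (n + 1)) A) R[X] :=
    ((algebraMap T[X] R[X]).comp (E : _ →+* T[X])).toAlgebra
  have h2 : IsLocalization ((Submonoid.map (C : T →+* T[X]) (Submonoid.powers h)).map
      E.symm.toRingEquiv) R[X] :=
    IsLocalization.isLocalization_of_base_ringEquiv _ _ E.symm.toRingEquiv
  refine ⟨E.symm (C h), ⟨?_⟩⟩
  have h3 : (Submonoid.map (C : T →+* T[X]) (Submonoid.powers h)).map E.symm.toRingEquiv =
      Submonoid.powers (E.symm (C h)) := by
    rw [Submonoid.map_powers, Submonoid.map_powers]; rfl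
  rw [h3] at h2
  have : IsScalarTower A (MvPolynomial (Fin (n + 1)) A) R[X] := .of_algebraMap_eq fun a => by
    change _ = (algebraMap T[X] R[X]) (E (algebraMap _ _ a))
    rw [AlgEquiv.commutes]
    change _ = Polynomial.map _ (C (algebraMap A T a))
    rw [Polynomial.map_C, ← IsScalarTower.algebraMap_apply A T R]; rfl
  exact (IsLocalization.algEquiv (Submonoid.powers (E.symm (C h))) _ R[X]).restrictScalars A

/-- A polynomial ring over a complete intersection algebra. -/
theorem IsCompleteIntersectionAlgebra.polynomial {A B : Type*} [CommRing A] [CommRing B]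
    [Algebra A B] (hB : IsCompleteIntersectionAlgebra A B) :
    IsCompleteIntersectionAlgebra A B[X] := by
  obtain ⟨n, h, P, ψ, hP, hψ, hk, _⟩ := hB.exists_surjective
  obtain ⟨h', ⟨e⟩⟩ := isLocalizationAway_polynomial_finSuccEquiv h
  refine .of_surjective e (P.map (algebraMap _ (Localization.Away h)[X])) hP.of_flat
    (Polynomial.mapAlgHom ψ) (Polynomial.map_surjective _ hψ) ?_
  rw [← Ideal.map_ofList, ← hk]
  exact Polynomial.ker_mapRingHom ψ.toRingHom

/-- Modulo `J` the polynomial `ρ` keeps a unit coefficient, so by McCoy's theorem it is a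
nonzerodivisor in `(R/J)[X]`. -/
theorem Polynomial.mem_map_C_of_mul_mem {R : Type*} [CommRing R] (J : Ideal R) {ρ g : R[X]} {j : ℕ}
    (hj : IsUnit (ρ.coeff j)) (h : ρ * g ∈ J.map (C : R →+* R[X])) :
    g ∈ J.map (C : R →+* R[X]) := by
  have hk : ∀ p : R[X], p ∈ J.map (C : R →+* R[X]) ↔ p.map (Ideal.Quotient.mk J) = 0 := by
    intro p
    have h1 := Polynomial.ker_mapRingHom (Ideal.Quotient.mk J)
    rw [Ideal.mk_ker] at h1
    rw [← h1, RingHom.mem_ker, coe_mapRingHom]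
  rw [hk] at h ⊢
  rw [Polynomial.map_mul] at h
  have hu : (ρ.map (Ideal.Quotient.mk J)) ∈ nonZeroDivisors _ := by
    refine Polynomial.mem_nonzeroDivisors_of_coeff_mem j ?_
    rw [coeff_map]
    exact (hj.map _).mem_nonZeroDivisors
  exact (mul_left_mem_nonZeroDivisors_eq_zero_iff hu).mp h

/-! ### Regularity over `V` and the subalgebras `C[h⁻¹]` and `C[q/β]`. -/

/-- `r ∈ C` is a nonzerodivisor modulo every nonzero element of the base ring `V`. -/
def IsRegularOver {V O : Type*} [CommRing V] [CommRing O] [Algebra V O] (C : Subalgebra V O)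
    (r : O) : Prop :=
  r ∈ C ∧ ∀ b : V, b ≠ 0 → ∀ z ∈ C, ∀ w ∈ C, r * z = b • w → ∃ z' ∈ C, z = b • z'

section

variable {V O : Type*} [CommRing V] [CommRing O] [Algebra V O]

/-- The subalgebra `C[h⁻¹]` for `h ∈ C`. -/
def Subalgebra.away (C : Subalgebra V O) (h : O) (hh : h ∈ C) : Subalgebra V O where
  carrier := {z | ∃ k : ℕ, h ^ k * z ∈ C}
  mul_mem' := by
    rintro a b ⟨k, hk⟩ ⟨l, hl⟩
    refine ⟨k + l, ?_⟩
    have := C.mul_mem hk hl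
    rwa [show h ^ k * a * (h ^ l * b) = h ^ (k + l) * (a * b) by ring] at this
  add_mem' := by
    rintro a b ⟨k, hk⟩ ⟨l, hl⟩
    refine ⟨k + l, ?_⟩
    have := C.add_mem (C.mul_mem (C.pow_mem hh l) hk) (C.mul_mem (C.pow_mem hh k) hl)
    rwa [show h ^ l * (h ^ k * a) + h ^ k * (h ^ l * b) = h ^ (k + l) * (a + b) by ring] at this
  algebraMap_mem' := fun r => ⟨0, by rw [pow_zero, one_mul]; exact C.algebraMap_mem r⟩

theorem Subalgebra.le_away (C : Subalgebra V O) (h : O) (hh : h ∈ C) : C ≤ C.away h hh :=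
  fun z hz => ⟨0, by simpa using hz⟩

/-- The subalgebra `C[y]`. -/
noncomputable def Subalgebra.adjoinElem (C : Subalgebra V O) (y : O) : Subalgebra V O :=
  ((Polynomial.aeval y : C[X] →ₐ[C] O).restrictScalars V).range

theorem Subalgebra.mem_adjoinElem {C : Subalgebra V O} {y z : O} :
    z ∈ C.adjoinElem y ↔ ∃ g : C[X], aeval y g = z := Iff.rfl

theorem Subalgebra.le_adjoinElem (C : Subalgebra V O) (y : O) : C ≤ C.adjoinElem y :=
  fun z hz => ⟨Polynomial.C ⟨z, hz⟩, by
    change aeval y (Polynomial.C (⟨z, hz⟩ : C)) = z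
    rw [aeval_C]; rfl⟩

theorem Subalgebra.self_mem_adjoinElem (C : Subalgebra V O) (y : O) : y ∈ C.adjoinElem y :=
  ⟨X, by
    change aeval y (X : C[X]) = y
    rw [aeval_X]⟩

theorem IsRegularOver.away [IsDomain O] {C : Subalgebra V O} {r h : O} (hr : IsRegularOver C r)
    (hh : h ∈ C) (hu : IsUnit h) : IsRegularOver (C.away h hh) r := by
  refine ⟨C.le_away h hh hr.1, ?_⟩
  rintro b hb z ⟨k, hk⟩ w ⟨l, hl⟩ hzw
  obtain ⟨z', hz', h1⟩ := hr.2 b hb (h ^ (k + l) * z)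
    (by rw [show h ^ (k + l) * z = h ^ l * (h ^ k * z) by ring]
        exact C.mul_mem (C.pow_mem hh l) hk) (h ^ (k + l) * w)
    (by rw [show h ^ (k + l) * w = h ^ k * (h ^ l * w) by ring]
        exact C.mul_mem (C.pow_mem hh k) hl)
    (by rw [mul_left_comm, hzw, mul_smul_comm])
  obtain ⟨u, hu⟩ := hu.pow (k + l)
  refine ⟨↑u⁻¹ * z', ⟨k + l, ?_⟩, ?_⟩
  · rwa [← hu, Units.mul_inv_cancel_left]
  · rw [← mul_smul_comm, ← h1, ← hu, Units.inv_mul_cancel_left]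

theorem Subalgebra.inv_mem_away {C : Subalgebra V O} {h h' : O} (hh : h ∈ C) (hh' : h * h' = 1) :
    h' ∈ C.away h hh :=
  ⟨1, by rw [pow_one, hh']; exact C.one_mem⟩

theorem IsCompleteIntersectionAlgebra.subalgebra_away [IsDomain O] {C : Subalgebra V O} {h : O}
    (hC : IsCompleteIntersectionAlgebra V C) (hh : h ∈ C) (hu : IsUnit h) :
    IsCompleteIntersectionAlgebra V (C.away h hh) := by
  refine hC.away (Subalgebra.inclusion (C.le_away h hh)) (Subalgebra.inclusion_injective _)
    ⟨h, hh⟩ ?_ ?_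
  · obtain ⟨u, rfl⟩ := hu
    refine IsUnit.of_mul_eq_one ⟨↑u⁻¹, Subalgebra.inv_mem_away hh u.mul_inv⟩ ?_
    exact Subtype.ext u.mul_inv
  · rintro ⟨z, k, hk⟩
    exact ⟨k, ⟨_, hk⟩, Subtype.ext rfl⟩

theorem IsRegularOver.dvd_of_pow_mul {C : Subalgebra V O} {q : O} (hq : IsRegularOver C q) {b : V}
    (hb : b ≠ 0) (n : ℕ) {z w : O} (hz : z ∈ C) (hw : w ∈ C) (h : q ^ n * z = b • w) :
    ∃ z' ∈ C, z = b • z' := by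
  induction n generalizing z w with
  | zero => exact ⟨w, hw, by simpa using h⟩
  | succ n ih =>
    obtain ⟨z', hz', h'⟩ := hq.2 b hb _ (C.mul_mem (C.pow_mem hq.1 n) hz) w hw
      (by rw [← h]; ring)
    exact ih hz hz' h'

theorem isRegularOver_range_of_isUnit_coeff (ι : V[X] →ₐ[V] O) (hι : Function.Injective ι)
    {ρ : V[X]} {j : ℕ} (hρ : IsUnit (ρ.coeff j)) : IsRegularOver ι.range (ι ρ) := by
  refine ⟨⟨ρ, rfl⟩, ?_⟩
  rintro b hb _ ⟨z, rfl⟩ _ ⟨w, rfl⟩ h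
  have h1 : ρ * z = b • w := hι (by rw [map_mul, map_smul]; exact h)
  have h2 : z ∈ (Ideal.span {b}).map (C : V →+* V[X]) := by
    refine Polynomial.mem_map_C_of_mul_mem _ hρ ?_
    rw [h1, smul_eq_C_mul]
    exact Ideal.mul_mem_right _ _ (Ideal.mem_map_of_mem _ (Ideal.mem_span_singleton_self b))
  rw [Ideal.map_span, Set.image_singleton, Ideal.mem_span_singleton] at h2
  obtain ⟨z', rfl⟩ := h2
  exact ⟨ι z', ⟨z', rfl⟩, by
    change ι _ = _
    rw [← smul_eq_C_mul, map_smul]⟩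

/-- Powers of `β` clear the denominators of `y = q/β`, so `C` and `C[y]` agree after inverting `β`.
-/
theorem aeval_pow_smul {C : Subalgebra V O} {q y : O} (hqC : q ∈ C) {β : V} (hy : β • y = q)
    (g : C[X]) (n : ℕ) (hn : g.natDegree ≤ n) : β ^ n • aeval y g ∈ C := by
  rw [aeval_eq_sum_range' (Nat.lt_succ_of_le hn), Finset.smul_sum]
  refine C.sum_mem fun i hi => ?_
  have hi' : i ≤ n := Nat.lt_succ_iff.mp (Finset.mem_range.mp hi)
  have : β ^ n • (g.coeff i • y ^ i) = β ^ (n - i) • ((g.coeff i : O) * q ^ i) := by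
    rw [← hy, _root_.smul_pow, Subalgebra.smul_def, smul_eq_mul, mul_smul_comm, smul_smul, ← pow_add,
      Nat.sub_add_cancel hi']
  rw [this]
  exact C.smul_mem (C.mul_mem (g.coeff i).2 (C.pow_mem hqC i)) _

/-- If `q` is regular over `V`, then `C[q/β]` is presented by the single relation `q = β Y`. -/
theorem IsRegularOver.dvd_of_aeval_eq_zero {C : Subalgebra V O} {q y : O} (hq : IsRegularOver C q)
    {β : V} (hβ : β ≠ 0) (hy : β • y = q) (g : C[X]) (hg : aeval y g = 0) :
    Polynomial.C (⟨q, hq.1⟩ : C) - Polynomial.C (algebraMap V C β) * X ∣ g := by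
  induction hn : g.natDegree using Nat.strong_induction_on generalizing g with
  | _ n ih =>
  rcases Nat.eq_zero_or_pos n with rfl | hpos
  · obtain ⟨c, rfl⟩ := natDegree_eq_zero.mp hn
    rw [aeval_C] at hg
    have : c = 0 := Subtype.ext hg
    rw [this, map_zero]
    exact dvd_zero _
  · obtain ⟨m, rfl⟩ : ∃ m, n = m + 1 := ⟨n - 1, by omega⟩
    set c := g.coeff (m + 1) with hc
    have hsplit : g = g.eraseLead + monomial (m + 1) c := by
      rw [hc, ← hn]; exact (eraseLead_add_monomial_natDegree_leadingCoeff g).symm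
    have hel : g.eraseLead.natDegree ≤ m := by
      have := eraseLead_natDegree_le g
      omega
    -- Multiplying `g(y) = 0` by `β^(m+1)` shows that `β` divides `q^(m+1) c` in `C`. Regularity of
    -- `q` gives `c = β c'`, and adding `c' X^m` times the relation lowers the degree.
    have h0 : q ^ (m + 1) * (c : O) = β • (-(β ^ m • aeval y g.eraseLead)) := by
      rw [hsplit, map_add, aeval_monomial] at hg
      have h1 : β ^ (m + 1) • (aeval y g.eraseLead + (c : O) * y ^ (m + 1)) = 0 := by
        rw [show aeval y g.eraseLead + (c : O) * y ^ (m + 1) = 0 from hg, smul_zero]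
      rw [smul_add, ← mul_smul_comm, ← _root_.smul_pow, hy] at h1
      rw [smul_neg, smul_smul, ← pow_succ']
      linear_combination h1
    obtain ⟨c', hc', hcc⟩ := hq.dvd_of_pow_mul hβ (m + 1) c.2
      (C.neg_mem (aeval_pow_smul hq.1 hy _ m hel)) h0
    set d : C[X] := Polynomial.C (⟨q, hq.1⟩ : C) - Polynomial.C (algebraMap V C β) * X with hd
    have hd0 : aeval y d = 0 := by
      rw [hd, map_sub, map_mul, aeval_C, aeval_C, aeval_X]
      change q - algebraMap V O β * y = 0
      rw [← Algebra.smul_def, hy, sub_self]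
    have hcβ : c = algebraMap V C β * ⟨c', hc'⟩ := Subtype.ext (by
      rw [hcc, Algebra.smul_def]; rfl)
    have key : g + d * monomial m (⟨c', hc'⟩ : C) =
        g.eraseLead + Polynomial.C (⟨q, hq.1⟩ : C) * monomial m (⟨c', hc'⟩ : C) := by
      have h2 : Polynomial.C (algebraMap V C β) * X * monomial m (⟨c', hc'⟩ : C) =
          monomial (m + 1) c := by
        rw [mul_assoc, X_mul_monomial, C_mul_monomial, hcβ]
      rw [hd, sub_mul, h2]
      conv_lhs => rw [hsplit]
      ring
    have hlt : (g + d * monomial m (⟨c', hc'⟩ : C)).natDegree < m + 1 := by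
      rw [key]
      refine Nat.lt_succ_of_le (natDegree_add_le_of_degree_le hel ?_)
      rw [C_mul_monomial]
      exact natDegree_monomial_le _
    have := ih _ hlt (g + d * monomial m (⟨c', hc'⟩ : C))
      (by rw [map_add, map_mul, hd0, hg, zero_mul, add_zero]) rfl
    exact (dvd_add_left (dvd_mul_right d _)).mp this

variable [IsDomain O] [FaithfulSMul V O]

theorem smul_left_cancel_of_faithful {b : V} (hb : b ≠ 0) {x y : O} (h : b • x = b • y) :
    x = y := by
  rw [Algebra.smul_def, Algebra.smul_def] at h
  refine mul_left_cancel₀ ?_ h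
  rwa [Ne, map_eq_zero_iff _ (FaithfulSMul.algebraMap_injective V O)]

variable [IsDomain V]

theorem IsCompleteIntersectionAlgebra.adjoinElem {C : Subalgebra V O}
    (hC : IsCompleteIntersectionAlgebra V C) {q y : O} (hq : IsRegularOver C q)
    {β : V} (hβ : β ≠ 0) (hy : β • y = q) :
    IsCompleteIntersectionAlgebra V (C.adjoinElem y) := by
  refine hC.polynomial.quotient
    ((Polynomial.aeval y : C[X] →ₐ[C] O).restrictScalars V).rangeRestrict
    (AlgHom.rangeRestrict_surjective _)
    (Polynomial.C (⟨q, hq.1⟩ : C) - Polynomial.C (algebraMap V C β) * X) ?_ ?_ ?_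
  · intro z hz
    refine (mul_eq_zero.mp hz).resolve_left fun h0 => hβ ?_
    have := congrArg (fun p : C[X] => p.coeff 1) h0
    simp only [coeff_sub, coeff_C_succ, coeff_C_mul, coeff_X_one, mul_one, zero_sub, coeff_zero,
      neg_eq_zero] at this
    have h1 : algebraMap V O β = 0 := congrArg Subtype.val this
    rwa [map_eq_zero_iff _ (FaithfulSMul.algebraMap_injective V O)] at h1
  · intro z hz
    exact hq.dvd_of_aeval_eq_zero hβ hy z (congrArg Subtype.val hz)
  · refine Subtype.ext ?_
    change aeval y (Polynomial.C (⟨q, hq.1⟩ : C) - Polynomial.C (algebraMap V C β) * X) = 0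
    rw [map_sub, map_mul, aeval_C, aeval_C, aeval_X]
    change q - algebraMap V O β * y = 0
    rw [← Algebra.smul_def, hy, sub_self]

/-- `C[y]/β` is `(C/(β, q))[Y]`, where a polynomial with a unit coefficient is a nonzerodivisor. -/
theorem IsRegularOver.adjoinElem_dvd {C : Subalgebra V O} {q y : O} (hq : IsRegularOver C q)
    {β : V} (hβ : β ≠ 0) (hy : β • y = q) {ρ : C[X]} {j : ℕ} (hρ : IsUnit (ρ.coeff j)) {z w : O}
    (hz : z ∈ C.adjoinElem y) (hw : w ∈ C.adjoinElem y) (h : aeval y ρ * z = β • w) :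
    ∃ z' ∈ C.adjoinElem y, z = β • z' := by
  obtain ⟨g, rfl⟩ := Subalgebra.mem_adjoinElem.mp hz
  obtain ⟨k, rfl⟩ := Subalgebra.mem_adjoinElem.mp hw
  let J : Ideal C := Ideal.span {algebraMap V C β, ⟨q, hq.1⟩}
  have hβJ : Polynomial.C (algebraMap V C β) ∈ J.map (Polynomial.C : C →+* C[X]) :=
    Ideal.mem_map_of_mem _ (Ideal.subset_span (by simp))
  have hqJ : Polynomial.C (⟨q, hq.1⟩ : C) ∈ J.map (Polynomial.C : C →+* C[X]) :=
    Ideal.mem_map_of_mem _ (Ideal.subset_span (by simp))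
  have h1 : aeval y (ρ * g - Polynomial.C (algebraMap V C β) * k) = 0 := by
    rw [map_sub, map_mul, map_mul, h, aeval_C, Algebra.smul_def, sub_eq_zero]; rfl
  obtain ⟨s, hs⟩ := hq.dvd_of_aeval_eq_zero hβ hy _ h1
  have h2 : ρ * g ∈ J.map (Polynomial.C : C →+* C[X]) := by
    rw [sub_eq_iff_eq_add.mp hs]
    refine Ideal.add_mem _ (Ideal.mul_mem_right _ _ (Ideal.sub_mem _ hqJ ?_)) ?_
    · exact Ideal.mul_mem_right _ _ hβJ
    · exact Ideal.mul_mem_right _ _ hβJ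
  have h3 := Polynomial.mem_map_C_of_mul_mem J hρ h2
  rw [Ideal.map_span, Set.image_pair, Ideal.mem_span_pair] at h3
  obtain ⟨a, b, rfl⟩ := h3
  refine ⟨aeval y a + aeval y b * y, Subalgebra.add_mem _ ⟨a, rfl⟩
    (Subalgebra.mul_mem _ ⟨b, rfl⟩ (C.self_mem_adjoinElem y)), ?_⟩
  rw [map_add, map_mul, map_mul, aeval_C, aeval_C]
  change aeval y a * algebraMap V O β + aeval y b * q = _
  rw [← hy, Algebra.smul_def, Algebra.smul_def]
  ring

/-- Regularity over `V` passes from `C` to `C[q/β]`, provided it holds modulo `β`. -/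
theorem IsRegularOver.adjoinElem [ValuationRing V] {C : Subalgebra V O} {q y : O}
    (hq : IsRegularOver C q)
    {β : V} (hβ : β ≠ 0) (hy : β • y = q) {ρ : C[X]} {j : ℕ} (hρ : IsUnit (ρ.coeff j))
    (hone : ∀ z ∈ C.adjoinElem y, (1 : O) ≠ β • z) {r₀ : O} (hr₀ : IsRegularOver C r₀)
    {γ δ : V} (hγ : γ ≠ 0) (hδ : δ ≠ 0) (hr : δ • aeval y ρ = γ • r₀) :
    IsRegularOver (C.adjoinElem y) (aeval y ρ) := by
  set r := aeval y ρ with hrdef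
  have hpow : ∀ n : ℕ, ∀ z ∈ C.adjoinElem y, ∀ w ∈ C.adjoinElem y, r * z = β ^ n • w →
      ∃ z' ∈ C.adjoinElem y, z = β ^ n • z' := by
    intro n
    induction n with
    | zero => exact fun z hz w hw h => ⟨z, hz, by simp⟩
    | succ n ih =>
      intro z hz w hw h
      obtain ⟨z₁, hz₁, rfl⟩ := hq.adjoinElem_dvd hβ hy hρ hz
        (Subalgebra.smul_mem _ hw (β ^ n)) (by rw [smul_smul, ← pow_succ']; exact h)
      obtain ⟨z₂, hz₂, rfl⟩ := ih z₁ hz₁ w hw (smul_left_cancel_of_faithful hβ (by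
        rw [← mul_smul_comm, h, smul_smul, pow_succ']))
      exact ⟨z₂, hz₂, by rw [smul_smul, pow_succ']⟩
  have hrC : r ∈ C.adjoinElem y := ⟨ρ, rfl⟩
  -- Regularity of `r₀` in `C` yields regularity of `r`, up to one factor `β`, for equations inside
  -- `C`.
  have main : ∀ b : V, b ≠ 0 → ∀ z ∈ C, ∀ w ∈ C, r * z = b • w → ∃ z' ∈ C, β • z = b • z' := by
    intro b hb z hz w hw h
    rcases ValuationRing.dvd_total δ γ with ⟨ε, rfl⟩ | ⟨ε, rfl⟩
    · have hr' : r = ε • r₀ := smul_left_cancel_of_faithful hδ (by rw [hr, smul_smul])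
      obtain ⟨z₁, hz₁, h1⟩ := hr₀.2 b hb (ε • z) (C.smul_mem hz _) w hw (by
        rw [← h, hr', mul_smul_comm, smul_mul_assoc])
      -- If `β` divided `ε`, it would divide `r`, hence `1` by regularity modulo `β`, contrary to
      -- `hone`. So `ε` divides `β`.
      rcases ValuationRing.dvd_total β ε with ⟨κ, rfl⟩ | ⟨κ, rfl⟩
      · obtain ⟨z₂, hz₂, h2⟩ := hpow 1 1 (Subalgebra.one_mem _) (κ • r₀)
          (C.le_adjoinElem y (C.smul_mem hr₀.1 _)) (by rw [mul_one, hr', smul_smul, pow_one])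
        exact absurd (by rw [h2, pow_one]) (hone z₂ hz₂)
      · refine ⟨κ • z₁, C.smul_mem hz₁ _, ?_⟩
        rw [mul_comm, ← smul_smul, h1, smul_comm]
    · have hr' : ε • r = r₀ := smul_left_cancel_of_faithful hγ (by rw [← hr, smul_smul])
      obtain ⟨z₁, hz₁, h1⟩ := hr₀.2 b hb z hz (ε • w) (C.smul_mem hw _) (by
        rw [← hr', smul_mul_assoc, h, smul_comm])
      exact ⟨β • z₁, C.smul_mem hz₁ _, by rw [h1, smul_comm]⟩
  refine ⟨hrC, fun b hb z hz w hw h => ?_⟩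
  obtain ⟨g, hg⟩ := Subalgebra.mem_adjoinElem.mp hz
  obtain ⟨k, hk⟩ := Subalgebra.mem_adjoinElem.mp hw
  -- Multiplication by `β^N` moves the equation into `C`, where `main` applies; `hpow` then removes
  -- the accumulated power of `β`.
  set N := max g.natDegree k.natDegree
  have hzN : β ^ N • z ∈ C := hg ▸ aeval_pow_smul hq.1 hy g N (le_max_left _ _)
  have hwN : β ^ N • w ∈ C := hk ▸ aeval_pow_smul hq.1 hy k N (le_max_right _ _)
  obtain ⟨z₁, hz₁, h1⟩ := main b hb _ hzN _ hwN (by rw [mul_smul_comm, h, smul_comm])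
  rw [smul_smul, ← pow_succ'] at h1
  obtain ⟨z₂, hz₂, rfl⟩ := hpow (N + 1) z₁ (C.le_adjoinElem y hz₁) w hw
    (smul_left_cancel_of_faithful hb (by
      rw [← mul_smul_comm, ← h1, mul_smul_comm, h, smul_comm]))
  refine ⟨z₂, hz₂, smul_left_cancel_of_faithful (pow_ne_zero (N + 1) hβ) (by rw [h1, smul_comm])⟩

end

/-! ### Immediate valuations and charts. -/

/-- A valuation `v` on `K'` whose restriction to `K` has valuation ring `V`, such that `K' / K` is
immediate. -/
structure IsImmediateValuation (V K : Type*) {K' Γ₀ : Type*} [CommRing V] [Field K] [Algebra V K]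
    [Field K'] [Algebra K K'] [LinearOrderedCommGroupWithZero Γ₀] (v : Valuation K' Γ₀) :
    Prop where
  le_one_iff : ∀ a : K, v (algebraMap K K' a) ≤ 1 ↔ ∃ c : V, algebraMap V K c = a
  exists_eq : ∀ z : K', z ≠ 0 → ∃ c : K, v (algebraMap K K' c) = v z
  exists_sub_lt : ∀ z : K', z ≠ 0 → ∃ a : K, v (z - algebraMap K K' a) < v z

/-- A complete intersection `V`-subalgebra `C` of `O` on which the evaluation `ev` is integral
and has kernel generated by `F` up to nonzero scalars. -/
structure IsChart {V K K' Γ₀ O : Type*} [CommRing V] [Field K] [Field K'] [Algebra K K']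
    [LinearOrderedCommGroupWithZero Γ₀] [CommRing O] [Algebra V O] [Algebra K O]
    (v : Valuation K' Γ₀) (ev : O →ₐ[K] K') (F : O) (C : Subalgebra V O) : Prop where
  ci : IsCompleteIntersectionAlgebra V C
  le_one : ∀ z ∈ C, v (ev z) ≤ 1
  ker : ∀ z ∈ C, ev z = 0 → ∃ b : V, b ≠ 0 ∧ ∃ w ∈ C, b • z = F * w

/-- `p` is a scalar multiple of a unit of `C`. -/
def IsUnitUpToScalar {V O : Type*} (K : Type*) [CommRing V] [Field K] [CommRing O] [Algebra V O]
    [Algebra K O] (C : Subalgebra V O) (p : O) : Prop :=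
  ∃ γ : K, ∃ U ∈ C, ∃ U' ∈ C, U * U' = 1 ∧ p = γ • U

/-- `p` is a scalar multiple of an element of `C` that is regular over `V`. -/
def IsRegularUpToScalar {V O : Type*} (K : Type*) [CommRing V] [Field K] [CommRing O] [Algebra V O]
    [Algebra K O] (C : Subalgebra V O) (p : O) : Prop :=
  ∃ γ : K, ∃ r, IsRegularOver C r ∧ p = γ • r

theorem IsUnitUpToScalar.mono {V O K : Type*} [CommRing V] [Field K] [CommRing O] [Algebra V O]
    [Algebra K O] {C C' : Subalgebra V O} {p : O} (h : IsUnitUpToScalar K C p) (hC : C ≤ C') :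
    IsUnitUpToScalar K C' p := by
  obtain ⟨γ, U, hU, U', hU', h1, h2⟩ := h
  exact ⟨γ, U, hC hU, U', hC hU', h1, h2⟩

section

variable {V K K' Γ₀ O : Type*} [CommRing V] [Field K] [Field K'] [Algebra K K']
  [LinearOrderedCommGroupWithZero Γ₀] [CommRing O] [Algebra V O] [Algebra K O]
  {v : Valuation K' Γ₀} {ev : O →ₐ[K] K'} {F : O} {C : Subalgebra V O}

theorem map_smul_of_tower [Algebra V K] [IsScalarTower V K O] (b : V) (z : O) :
    ev (b • z) = algebraMap K K' (algebraMap V K b) * ev z := by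
  rw [← algebraMap_smul K b z, map_smul, Algebra.smul_def]

theorem IsChart.map_unit_eq_one (hC : IsChart v ev F C) {U U' : O} (hU : U ∈ C) (hU' : U' ∈ C)
    (h : U * U' = 1) : v (ev U) = 1 := by
  refine le_antisymm (hC.le_one _ hU) ?_
  have h1 : v (ev U) * v (ev U') = 1 := by rw [← map_mul, ← map_mul, h, map_one, map_one]
  calc 1 = v (ev U) * v (ev U') := h1.symm
    _ ≤ v (ev U) * 1 := mul_le_mul_right (hC.le_one _ hU') _
    _ = _ := mul_one _

variable [IsDomain O]

theorem IsChart.away (hunit : ∀ z, ev z ≠ 0 → IsUnit z) (hC : IsChart v ev F C) {h : O}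
    (hh : h ∈ C) (hv : v (ev h) = 1) : IsChart v ev F (C.away h hh) := by
  have hu : IsUnit h := hunit h fun h0 => by simp [h0] at hv
  refine ⟨hC.ci.subalgebra_away hh hu, ?_, ?_⟩
  · rintro z ⟨k, hk⟩
    have := hC.le_one _ hk
    rwa [map_mul, map_pow, map_mul, map_pow, hv, one_pow, one_mul] at this
  · rintro z ⟨k, hk⟩ hz
    obtain ⟨b, hb, w, hw, h1⟩ := hC.ker _ hk (by rw [map_mul, hz, mul_zero])
    obtain ⟨u, hu⟩ := hu.pow k
    refine ⟨b, hb, ↑u⁻¹ * w, ⟨k, by rwa [← hu, Units.mul_inv_cancel_left]⟩, ?_⟩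
    rw [mul_left_comm, ← h1, mul_smul_comm, ← hu, Units.inv_mul_cancel_left]

theorem IsChart.exists_units (hunit : ∀ z, ev z ≠ 0 → IsUnit z) (hC : IsChart v ev F C)
    (H : Finset O) (hH : ∀ h ∈ H, h ∈ C ∧ v (ev h) = 1) :
    ∃ C', C ≤ C' ∧ IsChart v ev F C' ∧ (∀ h ∈ H, ∃ h' ∈ C', h * h' = 1) ∧
      ∀ r, IsRegularOver C r → IsRegularOver C' r := by
  classical
  induction H using Finset.induction_on with
  | empty => exact ⟨C, le_rfl, hC, by simp, fun _ h => h⟩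
  | insert h H _ ih =>
    obtain ⟨C', hle, hC', h1, h2⟩ := ih fun g hg => hH g (Finset.mem_insert_of_mem hg)
    obtain ⟨hh, hv⟩ := hH h (Finset.mem_insert_self _ _)
    have hu : IsUnit h := hunit h fun h0 => by simp [h0] at hv
    have hle' := C'.le_away h (hle hh)
    refine ⟨C'.away h (hle hh), hle.trans hle', hC'.away hunit (hle hh) hv, ?_,
      fun r hr => (h2 r hr).away (hle hh) hu⟩
    intro g hg
    rcases Finset.mem_insert.mp hg with rfl | hg
    · obtain ⟨g', hg'⟩ := hu.exists_right_inv
      exact ⟨g', Subalgebra.inv_mem_away (hle hh) hg', hg'⟩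
    · obtain ⟨g', hg', h3⟩ := h1 g hg
      exact ⟨g', hle' hg', h3⟩

end

section

variable {V K K' Γ₀ : Type*} [CommRing V] [Field K] [Algebra V K] [IsFractionRing V K]
  [Field K'] [Algebra K K'] [LinearOrderedCommGroupWithZero Γ₀] {v : Valuation K' Γ₀}

theorem IsImmediateValuation.isUnit_of_eq_one (hv : IsImmediateValuation V K v)
    {β : V} (h : v (algebraMap K K' (algebraMap V K β)) = 1) :
    IsUnit β := by
  obtain ⟨c, hc⟩ := (hv.le_one_iff (algebraMap V K β)⁻¹).mp
    (by rw [map_inv₀, map_inv₀, h, inv_one])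
  have h0 : algebraMap V K β ≠ 0 := fun h0 => by simp [h0] at h
  refine IsUnit.of_mul_eq_one c (IsFractionRing.injective V K ?_)
  rw [map_mul, hc, mul_inv_cancel₀ h0, map_one]

/-- Up to a scalar, every nonzero polynomial has integral coefficients, one of which is `1`. -/
theorem IsImmediateValuation.exists_primitive (hv : IsImmediateValuation V K v) {p : K[X]}
    (hp : p ≠ 0) :
    ∃ (γ : K) (ρ : V[X]) (j : ℕ), IsUnit (ρ.coeff j) ∧ p = γ • ρ.map (algebraMap V K) := by
  obtain ⟨j, hj, hmax⟩ := p.support.exists_max_image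
    (fun i => v (algebraMap K K' (p.coeff i))) (support_nonempty.mpr hp)
  have hj0 : p.coeff j ≠ 0 := mem_support_iff.mp hj
  have hlift : (p.coeff j)⁻¹ • p ∈ lifts (algebraMap V K) := by
    rw [lifts_iff_coeff_lifts]
    intro i
    rw [coeff_smul, smul_eq_mul]
    refine (hv.le_one_iff _).mp ?_
    by_cases hi : i ∈ p.support
    · rw [map_mul, map_mul, map_inv₀, map_inv₀, ← div_eq_inv_mul]
      exact div_le_one_of_le₀ (hmax i hi) zero_le
    · rw [notMem_support_iff.mp hi]; simp
  obtain ⟨ρ, hρ⟩ := (mem_lifts _).mp hlift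
  refine ⟨p.coeff j, ρ, j, ?_, ?_⟩
  · have h1 : algebraMap V K (ρ.coeff j) = 1 := by
      rw [← coeff_map, hρ, coeff_smul, smul_eq_mul, inv_mul_cancel₀ hj0]
    rw [IsFractionRing.injective V K (h1.trans (map_one _).symm)]
    exact isUnit_one
  · rw [hρ, smul_smul, mul_inv_cancel₀ hj0, one_smul]

end

section

variable {V K K' Γ₀ O : Type*} [CommRing V] [IsDomain V] [ValuationRing V] [Field K]
  [Algebra V K] [IsFractionRing V K] [Field K'] [Algebra K K']
  [LinearOrderedCommGroupWithZero Γ₀] [CommRing O] [IsDomain O] [Algebra V O] [Algebra K O]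
  [IsScalarTower V K O] {v : Valuation K' Γ₀} {ev : O →ₐ[K] K'} {F : O} {C : Subalgebra V O}

variable [FaithfulSMul V O]

theorem IsChart.adjoinElem (hC : IsChart v ev F C) {q y : O} (hq : IsRegularOver C q) {β : V}
    (hβ : β ≠ 0) (hy : β • y = q) (hvy : v (ev y) ≤ 1) : IsChart v ev F (C.adjoinElem y) := by
  refine ⟨hC.ci.adjoinElem hq hβ hy, ?_, ?_⟩
  · rintro z hz
    obtain ⟨g, rfl⟩ := Subalgebra.mem_adjoinElem.mp hz
    rw [aeval_eq_sum_range, map_sum]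
    refine v.map_sum_le fun i _ => ?_
    rw [Subalgebra.smul_def, smul_eq_mul, map_mul, map_mul, map_pow, map_pow]
    exact mul_le_one' (hC.le_one _ (g.coeff i).2) (pow_le_one' hvy i)
  · rintro z hz hz0
    obtain ⟨g, hg⟩ := Subalgebra.mem_adjoinElem.mp hz
    -- A power of `β` brings `z` into `C`; the scalar allowed in the kernel condition absorbs it.
    obtain ⟨b, hb, w, hw, h1⟩ := hC.ker (β ^ g.natDegree • z)
      (hg ▸ aeval_pow_smul hq.1 hy g _ le_rfl) (by rw [map_smul_of_tower, hz0, mul_zero])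
    exact ⟨b * β ^ g.natDegree, mul_ne_zero hb (pow_ne_zero _ hβ), w, C.le_adjoinElem y hw, by
      rw [← smul_smul, h1]⟩

/-- Regularity up to scalars of `P(Q)` passes from `C` to `C[Q/b]` when the `Q`-adic coefficients are
units up to scalars. -/
theorem IsChart.isRegularUpToScalar_adjoinElem (hv : IsImmediateValuation V K v)
    (hC : IsChart v ev F C) {q y : O} (hq : IsRegularOver C q) {β : V} (hβ : β ≠ 0) (hy : β • y = q) (hvy : v (ev y) ≤ 1)
    (hβu : ¬ IsUnit β) {ι : K[X] →ₐ[K] O} (hι : Function.Injective ι) {Q : K[X]} {b : K}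
    (hb : b ≠ 0) (hQ : ι Q = b • y) (P : K[X][X])
    (hP : ∀ i ∈ P.support, IsUnitUpToScalar K C (ι (P.coeff i))) (hP0 : P.eval Q ≠ 0)
    (hreg : IsRegularUpToScalar K C (ι (P.eval Q))) :
    IsRegularUpToScalar K (C.adjoinElem y) (ι (P.eval Q)) := by
  classical
  have hPne : P.support.Nonempty := by
    rw [Polynomial.support_nonempty]
    rintro rfl
    simp at hP0
  have hP' : ∀ i, ∃ γ : K, ∃ U U' : C, U * U' = 1 ∧
      (i ∈ P.support → ι (P.coeff i) = γ • (U : O)) := by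
    intro i
    by_cases hi : i ∈ P.support
    · obtain ⟨γ, U, hU, U', hU', h1, h2⟩ := hP i hi
      exact ⟨γ, ⟨U, hU⟩, ⟨U', hU'⟩, Subtype.ext h1, fun _ => h2⟩
    · exact ⟨0, 1, 1, one_mul 1, fun h => absurd h hi⟩
  choose γ U U' hUU' hγU using hP'
  have hγ : ∀ i ∈ P.support, γ i ≠ 0 := by
    intro i hi h0
    have := hγU i hi
    rw [h0, zero_smul, map_eq_zero_iff _ hι] at this
    exact (Polynomial.mem_support_iff.mp hi) this
  -- In powers of `y = Q/b` the coefficients are `γ i * b^i` times units. Dividing by one of maximal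
  -- value makes all of them integral and the `j`-th a unit.
  obtain ⟨j, hj, hmax⟩ := P.support.exists_max_image
    (fun i => v (algebraMap K K' (γ i * b ^ i))) hPne
  set c := γ j * b ^ j with hc
  have hc0 : c ≠ 0 := mul_ne_zero (hγ j hj) (pow_ne_zero _ hb)
  have hvc : v (algebraMap K K' c) ≠ 0 := by simpa using hc0
  have hε : ∀ i, ∃ ε : V, i ∈ P.support → algebraMap V K ε = γ i * b ^ i / c := by
    intro i
    by_cases hi : i ∈ P.support
    · obtain ⟨ε, hε⟩ := (hv.le_one_iff (γ i * b ^ i / c)).mp (by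
        rw [map_div₀, map_div₀]
        exact div_le_one_of_le₀ (hmax i hi) zero_le)
      exact ⟨ε, fun _ => hε⟩
    · exact ⟨0, fun h => absurd h hi⟩
  choose ε hε using hε
  let ρ : C[X] := ∑ i ∈ P.support, monomial i (ε i • U i)
  have hρj : IsUnit (ρ.coeff j) := by
    have h1 : ρ.coeff j = ε j • U j := by
      simp only [ρ, finsetSum_coeff, coeff_monomial]
      rw [Finset.sum_ite_eq' P.support j, if_pos hj]
    have h2 : ε j = 1 := IsFractionRing.injective V K (by
      rw [hε j hj, map_one, ← hc, div_self hc0])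
    rw [h1, h2, one_smul]
    exact IsUnit.of_mul_eq_one _ (hUU' j)
  have hρ : ι (P.eval Q) = c • aeval y ρ := by
    rw [eval_eq_sum, Polynomial.sum, map_sum, map_sum, Finset.smul_sum]
    refine Finset.sum_congr rfl fun i hi => ?_
    rw [aeval_monomial, map_mul, map_pow, hQ, hγU i hi]
    change _ = c • ((ε i • (U i : O)) * y ^ i)
    rw [← algebraMap_smul K (ε i) (U i : O), hε i hi, smul_mul_assoc _ _ (y ^ i), smul_smul,
      mul_div_cancel₀ _ hc0, _root_.smul_pow, smul_mul_smul_comm]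
  obtain ⟨γ₀, r₀, hr₀, h0⟩ := hreg
  have hγ₀ : γ₀ ≠ 0 := by
    rintro rfl
    rw [zero_smul, map_eq_zero_iff _ hι] at h0
    exact hP0 h0
  obtain ⟨g, d, hd, hgd⟩ := IsFractionRing.div_surjective V (γ₀ / c)
  have hdK : algebraMap V K d ≠ 0 := IsFractionRing.to_map_ne_zero_of_mem_nonZeroDivisors hd
  have hgK : algebraMap V K g ≠ 0 := by
    intro h
    rw [h, zero_div] at hgd
    exact div_ne_zero hγ₀ hc0 hgd.symm
  refine ⟨c, aeval y ρ, ?_, hρ⟩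
  refine hq.adjoinElem hβ hy hρj ?_ hr₀ (γ := g) (δ := d) (fun h => hgK (by rw [h, map_zero]))
    (fun h => hdK (by rw [h, map_zero])) ?_
  -- A chart takes only integral values, so `β z = 1` would force `β` to have value `1` and be a
  -- unit.
  · intro z hz h
    have h1 := (hC.adjoinElem hq hβ hy hvy).le_one z hz
    have h2 : v (algebraMap K K' (algebraMap V K β)) * v (ev z) = 1 := by
      rw [← map_mul, ← map_smul_of_tower, ← h, map_one, map_one]
    have h3 : v (algebraMap K K' (algebraMap V K β)) ≤ 1 := (hv.le_one_iff _).mpr ⟨β, rfl⟩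
    refine hβu (hv.isUnit_of_eq_one (le_antisymm h3 ?_))
    calc 1 = _ := h2.symm
      _ ≤ v (algebraMap K K' (algebraMap V K β)) * 1 := mul_le_mul_right h1 _
      _ = _ := mul_one _
  · have h1 : c • aeval y ρ = γ₀ • r₀ := by rw [← hρ, h0]
    have h2 : aeval y ρ = (γ₀ / c) • r₀ := by
      rw [div_eq_inv_mul, ← smul_smul, ← h1, smul_smul, inv_mul_cancel₀ hc0, one_smul]
    rw [h2, ← algebraMap_smul K d, ← algebraMap_smul K g, smul_smul, ← hgd, mul_div_cancel₀ _ hdK]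

end

/-! ### Induction on the degree. -/

theorem Polynomial.exists_adic_expansion {K : Type*} [Field K] {Q : K[X]} (hQ : Q.Monic)
    (hQd : 0 < Q.natDegree) (p : K[X]) :
    ∃ P : K[X][X], P.eval Q = p ∧ ∀ i, (P.coeff i).natDegree < Q.natDegree := by
  induction hn : p.natDegree using Nat.strong_induction_on generalizing p with
  | _ n ih =>
  by_cases hlt : p.natDegree < Q.natDegree
  · refine ⟨C p, eval_C, fun i => ?_⟩
    rw [coeff_C]
    split_ifs
    · exact hlt
    · simpa using hQd
  · obtain ⟨P, hP, hPd⟩ := ih (p /ₘ Q).natDegree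
      (by rw [natDegree_divByMonic p hQ]; omega) (p /ₘ Q) rfl
    refine ⟨C (p %ₘ Q) + X * P, ?_, fun i => ?_⟩
    · rw [eval_add, eval_C, eval_mul, eval_X, hP, modByMonic_add_div p Q]
    · cases i with
      | zero =>
        rw [coeff_add, coeff_C_zero, mul_coeff_zero, coeff_X_zero, zero_mul, add_zero]
        exact natDegree_modByMonic_lt p hQ (fun h => by simp [h] at hQd)
      | succ i =>
        rw [coeff_add, coeff_C_succ, zero_add, coeff_X_mul]
        exact hPd i

/-- Every finite set of polynomials is handled by a chart in which the nonzero ones of degree less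
than `m` are units up to scalars, and all nonzero ones are regular over `V` up to scalars. -/
def HasCharts {V K K' Γ₀ O : Type*} [CommRing V] [Field K] [Field K'] [Algebra K K']
    [LinearOrderedCommGroupWithZero Γ₀] [CommRing O] [Algebra V O] [Algebra K O]
    (v : Valuation K' Γ₀) (ev : O →ₐ[K] K') (F : O) (ι : K[X] →ₐ[K] O) (m : ℕ) : Prop :=
  ∀ G : Finset K[X], ∃ C : Subalgebra V O, IsChart v ev F C ∧
    ∀ g ∈ G, g ≠ 0 → (g.natDegree < m → IsUnitUpToScalar K C (ι g)) ∧
      IsRegularUpToScalar K C (ι g)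

theorem IsRegularUpToScalar.imp {V O K : Type*} [CommRing V] [Field K] [CommRing O] [Algebra V O]
    [Algebra K O] {C C' : Subalgebra V O} {p : O} (h : IsRegularUpToScalar K C p)
    (hC : ∀ r, IsRegularOver C r → IsRegularOver C' r) : IsRegularUpToScalar K C' p := by
  obtain ⟨γ, r, hr, h2⟩ := h
  exact ⟨γ, r, hC r hr, h2⟩

/-- A monic polynomial of degree `m` whose value at `x` is closer to zero than prescribed. -/
theorem IsImmediateValuation.exists_monic {V K K' Γ₀ : Type*} [CommRing V] [Field K] [Algebra V K]
    [Field K'] [Algebra K K'] [LinearOrderedCommGroupWithZero Γ₀] {v : Valuation K' Γ₀}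
    (hv : IsImmediateValuation V K v) {x : K'} {m : ℕ} (hm : 0 < m)
    (hx : ∀ p : K[X], p.Monic → p.natDegree = m → aeval x p ≠ 0)
    (M : Finset K[X]) (hM : ∀ p ∈ M, p.Monic ∧ p.natDegree = m) :
    ∃ Q : K[X], Q.Monic ∧ Q.natDegree = m ∧ ∀ p ∈ M, v (aeval x Q) < v (aeval x p) := by
  classical
  -- `X ^ m` is inserted so that a minimum exists even when `M` is empty; immediacy then provides a
  -- constant approximating the value of `p` at `x`.
  obtain ⟨p, hp, hmin⟩ := (insert (X ^ m) M).exists_min_image (fun p => v (aeval x p))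
    (Finset.insert_nonempty _ _)
  have hpm : p.Monic ∧ p.natDegree = m := by
    rcases Finset.mem_insert.mp hp with rfl | hp
    · exact ⟨monic_X_pow m, natDegree_X_pow m⟩
    · exact hM p hp
  obtain ⟨a, ha⟩ := hv.exists_sub_lt _ (hx p hpm.1 hpm.2)
  have hd : (C a).degree < p.degree := by
    rw [degree_eq_natDegree hpm.1.ne_zero, hpm.2]
    exact degree_C_le.trans_lt (by exact_mod_cast hm)
  refine ⟨p - C a, hpm.1.sub_of_left hd, ?_, fun q hq => ?_⟩
  · rw [natDegree_sub_C, hpm.2]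
  · rw [map_sub, aeval_C]
    exact ha.trans_le (hmin q (Finset.mem_insert_of_mem hq))

section

variable {V K K' Γ₀ O : Type*} [CommRing V] [IsDomain V] [ValuationRing V] [Field K]
  [Algebra V K] [IsFractionRing V K] [Field K'] [Algebra K K']
  [LinearOrderedCommGroupWithZero Γ₀] [CommRing O] [IsDomain O] [Algebra V O] [Algebra K O]
  [IsScalarTower V K O] {v : Valuation K' Γ₀} {ev : O →ₐ[K] K'} {F : O} [FaithfulSMul V O]

/-- Adjoining to a chart `C` the element `Q / b`, where `v (Q) = v (b)`. -/
theorem IsChart.exists_adjoin (hv : IsImmediateValuation V K v) {C : Subalgebra V O}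
    (hC : IsChart v ev F C) {ι : K[X] →ₐ[K] O} (hι : Function.Injective ι)
    {Q : K[X]} (hQ0 : ev (ι Q) ≠ 0)
    (hQreg : IsRegularUpToScalar K C (ι Q)) (expand : K[X] → K[X][X])
    (hexp : ∀ p, (expand p).eval Q = p) (G : Finset K[X])
    (hG : ∀ g ∈ G, g ≠ 0 → IsRegularUpToScalar K C (ι g))
    (hcoeff : ∀ g ∈ G, ∀ i ∈ (expand g).support, IsUnitUpToScalar K C (ι ((expand g).coeff i)))
    {b : K} (hb : v (algebraMap K K' b) = v (ev (ι Q))) :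
    ∃ C', C ≤ C' ∧ IsChart v ev F C' ∧ b⁻¹ • ι Q ∈ C' ∧
      ∀ g ∈ G, g ≠ 0 → IsRegularUpToScalar K C' (ι g) := by
  have hb0 : b ≠ 0 := by
    rintro rfl
    rw [map_zero, map_zero, eq_comm, map_eq_zero] at hb
    exact hQ0 hb
  obtain ⟨γ, q, hq, hQq⟩ := hQreg
  have hγ : γ ≠ 0 := by
    rintro rfl
    rw [hQq, zero_smul, map_zero] at hQ0
    exact hQ0 rfl
  have hvγ : v (algebraMap K K' γ) ≠ 0 := by simpa using hγ
  set y := b⁻¹ • ι Q with hy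
  have hQy : ι Q = b • y := by rw [hy, smul_smul, mul_inv_cancel₀ hb0, one_smul]
  have hvy : v (ev y) = 1 := by
    rw [hy, map_smul, Algebra.smul_def, map_mul, ← hb, ← map_mul, ← map_mul, inv_mul_cancel₀ hb0,
      map_one, map_one]
  have hvq : v (algebraMap K K' (b / γ)) ≤ 1 := by
    have h1 : v (algebraMap K K' (b / γ)) = v (ev q) := by
      rw [map_div₀, map_div₀, hb, hQq, map_smul, Algebra.smul_def, map_mul,
        mul_div_cancel_left₀ _ hvγ]
    rw [h1]
    exact hC.le_one q hq.1
  obtain ⟨β, hβ⟩ := (hv.le_one_iff _).mp hvq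
  have hβ0 : β ≠ 0 := by
    rintro rfl
    rw [map_zero] at hβ
    exact div_ne_zero hb0 hγ hβ.symm
  have hβy : β • y = q := by
    rw [← algebraMap_smul K β y, hβ, hy, hQq, smul_smul, smul_smul,
      show b / γ * b⁻¹ * γ = 1 by field_simp, one_smul]
  -- If `β` is a unit, `y` already lies in `C`; otherwise preservation of regularity needs `β` to be
  -- a nonunit.
  by_cases hβu : IsUnit β
  · refine ⟨C, le_rfl, hC, ?_, hG⟩
    obtain ⟨u, rfl⟩ := hβu
    have : y = (↑u⁻¹ : V) • q := by rw [← hβy, smul_smul, Units.inv_mul, one_smul]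
    rw [this]
    exact C.smul_mem hq.1 _
  · refine ⟨C.adjoinElem y, C.le_adjoinElem y, hC.adjoinElem hq hβ0 hβy hvy.le,
      C.self_mem_adjoinElem y, fun g hg hg0 => ?_⟩
    have := hC.isRegularUpToScalar_adjoinElem hv hq hβ0 hβy hvy.le hβu hι hb0 hQy (expand g)
      (hcoeff g hg) (by rwa [hexp]) (by rw [hexp]; exact hG g hg hg0)
    rwa [hexp] at this

/-- If `g = c + Q` with `c` a unit up to scalars that dominates `Q`, then `g` becomes a unit up to
scalars after adjoining `Q / b` and localizing. -/
theorem IsChart.exists_smul_eq_add (hv : IsImmediateValuation V K v) {C : Subalgebra V O}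
    (hC : IsChart v ev F C) {c Q : O} (hc : IsUnitUpToScalar K C c) {b : K}
    (hb : v (algebraMap K K' b) = v (ev Q)) (hbQ : b⁻¹ • Q ∈ C) (hb0 : b ≠ 0)
    (hlt : v (ev Q) < v (ev c)) :
    ∃ h ∈ C, v (ev h) = 1 ∧ ∃ γ : K, c + Q = γ • h := by
  obtain ⟨γ, U, hU, U', hU', hUU, rfl⟩ := hc
  have hvU := hC.map_unit_eq_one hU hU' hUU
  have hvc : v (ev (γ • U)) = v (algebraMap K K' γ) := by
    rw [map_smul, Algebra.smul_def, map_mul, hvU, mul_one]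
  have hvγ : v (algebraMap K K' γ) ≠ 0 := by
    rw [← hvc]; exact (zero_le.trans_lt hlt).ne'
  have hγ : γ ≠ 0 := by rintro rfl; simp at hvγ
  obtain ⟨ε, hε⟩ := (hv.le_one_iff (b / γ)).mp (by
    rw [map_div₀, map_div₀, hb]
    exact div_le_one_of_le₀ (hvc ▸ hlt.le) zero_le)
  have hsum : γ • U + Q = γ • (U + ε • (b⁻¹ • Q)) := by
    rw [← algebraMap_smul K ε, hε, smul_add, smul_smul, smul_smul,
      show γ * (b / γ) * b⁻¹ = 1 by field_simp, one_smul]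
  refine ⟨U + ε • (b⁻¹ • Q), C.add_mem hU (C.smul_mem hbQ _), ?_, γ, hsum⟩
  have h1 : v (ev (γ • U + Q)) = v (algebraMap K K' γ) := by
    rw [map_add, Valuation.map_add_eq_of_lt_left v hlt, hvc]
  rw [hsum, map_smul, Algebra.smul_def, map_mul] at h1
  exact mul_left_cancel₀ hvγ (by rw [h1, mul_one])

theorem HasCharts.succ (hv : IsImmediateValuation V K v) {ι : K[X] →ₐ[K] O}
    (hι : Function.Injective ι) (hunit : ∀ z, ev z ≠ 0 → IsUnit z) {x : K'}
    (hev : ∀ p, ev (ι p) = aeval x p) {m : ℕ} (hm : 0 < m)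
    (hx : ∀ p : K[X], p ≠ 0 → p.natDegree ≤ m → aeval x p ≠ 0)
    (h : HasCharts (V := V) v ev F ι m) : HasCharts (V := V) v ev F ι (m + 1) := by
  classical
  intro G
  let N : K[X] → K[X] := fun g => C g.leadingCoeff⁻¹ * g
  let G' := G.filter fun g => g ≠ 0 ∧ g.natDegree = m
  have hN : ∀ g ∈ G', (N g).Monic ∧ (N g).natDegree = m := by
    intro g hg
    obtain ⟨-, hg0, hgm⟩ := Finset.mem_filter.mp hg
    have hl : g.leadingCoeff ≠ 0 := leadingCoeff_ne_zero.mpr hg0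
    refine ⟨monic_C_mul_of_mul_leadingCoeff_eq_one (inv_mul_cancel₀ hl), ?_⟩
    rw [natDegree_C_mul (inv_ne_zero hl), hgm]
  obtain ⟨Q, hQ, hQm, hQlt⟩ := hv.exists_monic hm
    (fun p hp hpm => hx p hp.ne_zero hpm.le) (G'.image N) (by
      intro p hp
      obtain ⟨g, hg, rfl⟩ := Finset.mem_image.mp hp
      exact hN g hg)
  have hQ0 : aeval x Q ≠ 0 := hx Q hQ.ne_zero hQm.le
  choose expand hexp hdeg using Polynomial.exists_adic_expansion hQ (hQm ▸ hm)
  let coeffs := G.biUnion fun g => (expand g).support.image (expand g).coeff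
  -- Besides `G`, the chart must handle `Q`, the differences `N g - Q` and the `Q`-adic
  -- coefficients; the last two have degree less than `m`, so they become units up to scalars.
  obtain ⟨C₀, hC₀, hgood⟩ := h (G ∪ {Q} ∪ G'.image (fun g => N g - Q) ∪ coeffs)
  obtain ⟨b, hb⟩ := hv.exists_eq _ hQ0
  have hb0 : b ≠ 0 := by
    rintro rfl
    rw [map_zero, map_zero, eq_comm, map_eq_zero] at hb
    exact hQ0 hb
  obtain ⟨C₁, hle₁, hC₁, hy, hreg₁⟩ := hC₀.exists_adjoin hv hι (by rwa [hev])
    (hgood Q (by simp) hQ.ne_zero).2 expand hexp G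
    (fun g hg hg0 => (hgood g (by simp [hg]) hg0).2)
    (fun g hg i hi => (hgood _ (by
      refine Finset.mem_union_right _ (Finset.mem_biUnion.mpr ⟨g, hg, ?_⟩)
      exact Finset.mem_image_of_mem _ hi) (mem_support_iff.mp hi)).1 (hQm ▸ hdeg g i))
    (b := b) (by rw [hb, hev])
  have hex : ∀ g ∈ G', ∃ h ∈ C₁, v (ev h) = 1 ∧ ∃ γ : K, ι (N g) = γ • h := by
    intro g hg
    have hlt : v (aeval x Q) < v (aeval x (N g)) := hQlt _ (Finset.mem_image_of_mem _ hg)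
    have hlt' : v (aeval x Q) < v (aeval x (N g - Q)) := by
      rw [map_sub, Valuation.map_sub_eq_of_lt_left v hlt]
      exact hlt
    have hne : N g - Q ≠ 0 := by
      intro h0
      simp [h0] at hlt'
    have hdegc : (N g - Q).natDegree < m := by
      have h1 := degree_sub_lt_left (p := N g) (q := Q)
        (by rw [degree_eq_natDegree (hN g hg).1.ne_zero, degree_eq_natDegree hQ.ne_zero,
          (hN g hg).2, hQm]) (hN g hg).1.ne_zero (by rw [(hN g hg).1, hQ])
      have h2 := natDegree_lt_natDegree hne h1
      rwa [(hN g hg).2] at h2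
    have hc := (hgood (N g - Q) (by
      refine Finset.mem_union_left _ (Finset.mem_union_right _ ?_)
      exact Finset.mem_image_of_mem (fun g => N g - Q) hg) hne).1 hdegc
    obtain ⟨h, hh, hvh, γ, hγ⟩ := hC₁.exists_smul_eq_add hv (hc.mono hle₁) (b := b)
      (Q := ι Q) (by rw [hb, hev]) hy hb0 (by rwa [hev, hev])
    exact ⟨h, hh, hvh, γ, by rw [← hγ, ← map_add, sub_add_cancel]⟩
  choose! H hH hvH γ hγ using hex
  obtain ⟨C₂, hle₂, hC₂, hinv, hreg₂⟩ := hC₁.exists_units hunit (G'.image H) (by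
    intro h hh
    obtain ⟨g, hg, rfl⟩ := Finset.mem_image.mp hh
    exact ⟨hH g hg, hvH g hg⟩)
  refine ⟨C₂, hC₂, fun g hg hg0 => ⟨fun hgm => ?_, (hreg₁ g hg hg0).imp hreg₂⟩⟩
  rcases (Nat.lt_succ_iff.mp hgm).lt_or_eq with hlt | heq
  · exact ((hgood g (by simp [hg]) hg0).1 hlt).mono (hle₁.trans hle₂)
  · have hg' : g ∈ G' := Finset.mem_filter.mpr ⟨hg, hg0, heq⟩
    obtain ⟨h', hh', hhh⟩ := hinv (H g) (Finset.mem_image_of_mem _ hg')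
    refine ⟨g.leadingCoeff * γ g, H g, hle₂ (hH g hg'), h', hh', hhh, ?_⟩
    rw [← smul_smul, ← hγ g hg', ← map_smul, smul_eq_C_mul, ← mul_assoc, ← C_mul,
      mul_inv_cancel₀ (leadingCoeff_ne_zero.mpr hg0), C_1, one_mul]

end

theorem IsCompleteIntersectionAlgebra.self (A : Type*) [CommRing A] [Nontrivial A] :
    IsCompleteIntersectionAlgebra A A := by
  let e : MvPolynomial (Fin 0) A ≃ₐ[A] A := MvPolynomial.isEmptyAlgEquiv A (Fin 0)
  let e' : MvPolynomial (Fin 0) A ≃ₐ[A] Localization.Away (1 : MvPolynomial (Fin 0) A) :=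
    (IsLocalization.atOne (MvPolynomial (Fin 0) A)
      (Localization.Away (1 : MvPolynomial (Fin 0) A))).restrictScalars A
  refine .of_surjective (e'.symm.trans e) [] (IsWeaklyRegular.nil _ _) (AlgHom.id A A)
    Function.surjective_id ?_
  rw [Ideal.ofList_nil]
  exact (RingHom.injective_iff_ker_eq_bot _).mp Function.injective_id

/-- The chart is `V[X]`. Constants are scalars times `1`, nonzero polynomials are scalars times
primitive ones, and clearing the denominators of a cofactor of `f` gives the kernel condition. -/
theorem hasCharts_one {V K K' Γ₀ O : Type*} [CommRing V] [IsDomain V] [Field K] [Algebra V K]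
    [IsFractionRing V K] [Field K'] [Algebra K K'] [LinearOrderedCommGroupWithZero Γ₀]
    [CommRing O] [Algebra V O] [Algebra K O] [IsScalarTower V K O] {v : Valuation K' Γ₀}
    {ev : O →ₐ[K] K'} (hv : IsImmediateValuation V K v) {ι : K[X] →ₐ[K] O}
    (hι : Function.Injective ι) {x : K'} (hev : ∀ p, ev (ι p) = aeval x p) (hvx : v x ≤ 1)
    {f : K[X]} (hf : ∀ p, aeval x p = 0 → f ∣ p) :
    HasCharts (V := V) v ev (ι f) ι 1 := by
  intro G
  let φ : V[X] →ₐ[V] O := (ι.restrictScalars V).comp (Polynomial.mapAlgHom (Algebra.ofId V K))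
  have hφ' : ∀ p, φ p = ι (p.map (algebraMap V K)) := fun p => rfl
  have hφ : Function.Injective φ := hι.comp (map_injective _ (IsFractionRing.injective V K))
  refine ⟨φ.range, ⟨?_, ?_, ?_⟩, fun g _ hg0 => ⟨fun hg => ?_, ?_⟩⟩
  · exact (IsCompleteIntersectionAlgebra.self V).polynomial.of_algEquiv
      (AlgEquiv.ofInjective φ hφ)
  · rintro _ ⟨p, rfl⟩
    change v (ev (φ p)) ≤ 1
    rw [hφ', hev, aeval_eq_sum_range]
    refine v.map_sum_le fun i _ => ?_
    rw [Algebra.smul_def, map_mul, map_pow, coeff_map]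
    exact mul_le_one' ((hv.le_one_iff _).mpr ⟨_, rfl⟩) (pow_le_one' hvx i)
  · rintro _ ⟨p, rfl⟩ hp
    change ev (φ p) = 0 at hp
    rw [hφ', hev] at hp
    obtain ⟨g, hg⟩ := hf _ hp
    obtain ⟨b, hb, hbg⟩ := IsLocalization.integerNormalization_spec (nonZeroDivisors V) g
    refine ⟨b, nonZeroDivisors.ne_zero hb,
      φ (IsLocalization.integerNormalization (nonZeroDivisors V) g), ⟨_, rfl⟩, ?_⟩
    change b • φ p = _
    rw [hφ', hφ', hbg, ← map_mul, hg]
    change b • ι (f * g) = ι (f * (b • g))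
    rw [mul_smul_comm, ← algebraMap_smul K b (f * g), map_smul, algebraMap_smul]
  · obtain ⟨a, rfl⟩ := natDegree_eq_zero.mp (Nat.lt_one_iff.mp hg)
    refine ⟨a, 1, Subalgebra.one_mem _, 1, Subalgebra.one_mem _, one_mul 1, ?_⟩
    rw [← map_one ι, ← map_smul, smul_eq_C_mul, mul_one]
  · obtain ⟨γ, ρ, j, hj, rfl⟩ := hv.exists_primitive hg0
    refine ⟨γ, φ ρ, isRegularOver_range_of_isUnit_coeff φ hφ hj, ?_⟩
    rw [map_smul, hφ']

theorem IsImmediateValuation.hasCharts {V K K' Γ₀ O : Type*} [CommRing V]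
    [IsDomain V] [ValuationRing V] [Field K] [Algebra V K] [IsFractionRing V K] [Field K']
    [Algebra K K'] [LinearOrderedCommGroupWithZero Γ₀] [CommRing O] [IsDomain O] [Algebra V O]
    [Algebra K O] [IsScalarTower V K O] [FaithfulSMul V O] {v : Valuation K' Γ₀} {ev : O →ₐ[K] K'}
    (hv : IsImmediateValuation V K v) {ι : K[X] →ₐ[K] O} (hι : Function.Injective ι)
    (hunit : ∀ z, ev z ≠ 0 → IsUnit z)
    {x : K'} (hev : ∀ p, ev (ι p) = aeval x p) (hvx : v x ≤ 1) {f : K[X]}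
    (hf : ∀ p, aeval x p = 0 → f ∣ p) (m : ℕ) (hm : m < f.natDegree) :
    HasCharts (V := V) v ev (ι f) ι (m + 1) := by
  induction m with
  | zero => exact hasCharts_one hv hι hev hvx hf
  | succ m ih =>
    -- A nonzero polynomial vanishing at `x` is a multiple of `f`, so its degree is too large.
    refine (ih (by omega)).succ hv hι hunit hev (by omega) fun p hp hpm h0 => ?_
    have := natDegree_le_of_dvd (hf p h0) hp
    omega

/-! ### From charts to subalgebras of `K'`. -/

section

variable {V K K' Γ₀ O : Type*} [CommRing V] [IsDomain V] [ValuationRing V] [Field K]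
  [Algebra V K] [IsFractionRing V K] [Field K'] [Algebra K K'] [Algebra V K']
  [IsScalarTower V K K'] [LinearOrderedCommGroupWithZero Γ₀] {v : Valuation K' Γ₀}

theorem HasCharts.exists_subalgebra [CommRing O] [IsDomain O] [Algebra V O] [Algebra K O]
    [IsScalarTower V K O] [FaithfulSMul V O] {ev : O →ₐ[K] K'}
    (hv : IsImmediateValuation V K v) {ι : K[X] →ₐ[K] O} (hι : Function.Injective ι)
    {x : K'} (hev : ∀ p, ev (ι p) = aeval x p) {f : K[X]} (hf0 : f ≠ 0) (hfx : aeval x f = 0)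
    {m : ℕ} (h : HasCharts (V := V) v ev (ι f) ι m)
    (hsurj : ∀ e : K', ∃ p : K[X], p.natDegree < m ∧ aeval x p = e) (E : Finset K')
    (hE : ∀ e ∈ E, v e ≤ 1) :
    ∃ D : Subalgebra V K', IsCompleteIntersectionAlgebra V D ∧ (∀ z ∈ D, v z ≤ 1) ∧
      ∀ e ∈ E, e ∈ D := by
  classical
  choose p hpm hp using hsurj
  obtain ⟨C, hC, hgood⟩ := h (insert f (E.image p))
  obtain ⟨γ, r, hr, hfr⟩ := (hgood f (Finset.mem_insert_self _ _) hf0).2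
  have hιf : ι f ≠ 0 := by rwa [Ne, map_eq_zero_iff _ hι]
  have hγ : γ ≠ 0 := by rintro rfl; exact hιf (by rw [hfr, zero_smul])
  have hr0 : r ≠ 0 := by rintro rfl; exact hιf (by rw [hfr, smul_zero])
  have hevr : ev r = 0 := by
    have h1 : ev (ι f) = γ • ev r := by rw [hfr, map_smul]
    rw [hev, hfx, eq_comm, smul_eq_zero] at h1
    exact h1.resolve_left hγ
  let ψ : C →ₐ[V] K' := (ev.restrictScalars V).comp C.val
  refine ⟨ψ.range, ?_, ?_, fun e he => ?_⟩
  · refine hC.ci.quotient ψ.rangeRestrict ψ.rangeRestrict_surjective ⟨r, hr.1⟩ ?_ ?_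
      (Subtype.ext hevr)
    · intro z hz
      exact (mul_eq_zero.mp hz).resolve_left fun h0 => hr0 (congrArg Subtype.val h0)
    · rintro ⟨z, hz⟩ hz0
      obtain ⟨b, hb, w, hw, h1⟩ := hC.ker z hz (congrArg Subtype.val hz0)
      obtain ⟨a, d, hd, rfl⟩ := IsFractionRing.div_surjective V γ
      have hdK : algebraMap V K d ≠ 0 := IsFractionRing.to_map_ne_zero_of_mem_nonZeroDivisors hd
      -- With `γ = a/d`, an element `z` of the kernel satisfies `d b z = r (a w)`. Regularity of `r`
      -- makes `a w` divisible by `d b`, whence `z` is a multiple of `r`.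
      have h2 : r * (a • w) = (d * b) • z := by
        rw [← smul_smul, h1, hfr, ← algebraMap_smul K d, smul_mul_assoc, smul_smul,
          mul_div_cancel₀ _ hdK, algebraMap_smul, mul_smul_comm]
      obtain ⟨w', hw', h3⟩ := hr.2 (d * b) (mul_ne_zero (nonZeroDivisors.ne_zero hd) hb) _
        (C.smul_mem hw a) _ hz h2
      refine ⟨⟨w', hw'⟩, Subtype.ext (smul_left_cancel_of_faithful
        (mul_ne_zero (nonZeroDivisors.ne_zero hd) hb) ?_)⟩
      rw [← h2, h3, mul_smul_comm]
      rfl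
  · rintro _ ⟨z, rfl⟩
    exact hC.le_one z z.2
  · by_cases he0 : e = 0
    · rw [he0]; exact Subalgebra.zero_mem _
    have hpe : p e ≠ 0 := by
      intro h0
      have := hp e
      rw [h0, map_zero] at this
      exact he0 this.symm
    obtain ⟨δ, U, hU, U', hU', hUU, hδ⟩ := (hgood (p e)
      (Finset.mem_insert_of_mem (Finset.mem_image_of_mem p he)) hpe).1 (hpm e)
    have h1 : e = algebraMap K K' δ * ev U := by
      rw [← Algebra.smul_def, ← map_smul, ← hδ, hev, hp]
    -- Units of a chart have value `1`, so `δ` has the value of `e` and lies in `V`.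
    obtain ⟨c, hc⟩ := (hv.le_one_iff δ).mp (by
      have h2 := hE e he
      rwa [h1, map_mul, hC.map_unit_eq_one hU hU' hUU, mul_one] at h2)
    refine ⟨c • (⟨U, hU⟩ : C), ?_⟩
    change ψ (c • (⟨U, hU⟩ : C)) = e
    rw [h1, ← hc, map_smul, Algebra.smul_def, IsScalarTower.algebraMap_apply V K K']
    rfl

/-- The charts live in `K[X]_(f)` because there every element with nonzero image in `K'` is
invertible, while `f` itself remains a nonzero element of a domain. -/
theorem IsImmediateValuation.exists_subalgebra (hv : IsImmediateValuation V K v) {x : K'}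
    (hvx : v x ≤ 1) (hx : IsIntegral K x)
    (hsurj : Function.Surjective (aeval x : K[X] → K')) (E : Finset K')
    (hE : ∀ e ∈ E, v e ≤ 1) :
    ∃ D : Subalgebra V K', IsCompleteIntersectionAlgebra V D ∧ (∀ z ∈ D, v z ≤ 1) ∧
      ∀ e ∈ E, e ∈ D := by
  set f := minpoly K x with hf
  have hf0 : f ≠ 0 := minpoly.ne_zero hx
  have hprime : (Ideal.span {f}).IsPrime :=
    (Ideal.span_singleton_prime hf0).mpr (minpoly.prime hx)
  let O := Localization.AtPrime (Ideal.span {f})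
  have hdom : IsDomain O := IsLocalization.isDomain_localization
    (Ideal.primeCompl_le_nonZeroDivisors _)
  let ι : K[X] →ₐ[K] O := IsScalarTower.toAlgHom K K[X] O
  have hι : Function.Injective ι := IsLocalization.injective O
    (Ideal.primeCompl_le_nonZeroDivisors (Ideal.span {f}))
  have hmem : ∀ p : K[X], p ∈ (Ideal.span {f}).primeCompl ↔ aeval x p ≠ 0 := fun p => by
    rw [Ideal.mem_primeCompl_iff, Ideal.mem_span_singleton]
    exact minpoly.dvd_iff.not
  let ev : O →ₐ[K] K' := IsLocalization.liftAlgHom (M := (Ideal.span {f}).primeCompl)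
    (f := (aeval x : K[X] →ₐ[K] K')) fun s => ((hmem s).mp s.2).isUnit
  have hev : ∀ p, ev (ι p) = aeval x p := fun p => IsLocalization.lift_eq _ p
  have hunit : ∀ z, ev z ≠ 0 → IsUnit z := by
    intro z hz
    obtain ⟨⟨a, s⟩, has⟩ := IsLocalization.surj (Ideal.span {f}).primeCompl z
    have hsa : ev z * aeval x (s : K[X]) = aeval x a := by
      rw [← hev, ← hev, ← map_mul]; exact congrArg ev has
    have ha : a ∈ (Ideal.span {f}).primeCompl := by
      rw [hmem, ← hsa]
      exact mul_ne_zero hz ((hmem s).mp s.2)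
    have h1 : IsUnit (algebraMap K[X] O a) := IsLocalization.map_units O ⟨a, ha⟩
    rw [← has] at h1
    exact isUnit_of_mul_isUnit_left h1
  have hfaith : FaithfulSMul V O := by
    rw [faithfulSMul_iff_algebraMap_injective, IsScalarTower.algebraMap_eq V K O]
    exact (algebraMap K O).injective.comp (IsFractionRing.injective V K)
  have hd : 0 < f.natDegree := minpoly.natDegree_pos hx
  obtain ⟨m, hm⟩ : ∃ m, f.natDegree = m + 1 := ⟨f.natDegree - 1, by omega⟩
  have hch := hv.hasCharts hι hunit hev hvx (f := f) (fun p hp => minpoly.dvd K x hp) m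
    (by omega)
  refine hch.exists_subalgebra hv hι hev hf0 (minpoly.aeval K x) (fun e => ?_) E hE
  obtain ⟨p, rfl⟩ := hsurj e
  refine ⟨p %ₘ f, ?_, ?_⟩
  · rw [← hm]
    refine natDegree_modByMonic_lt p (minpoly.monic hx) fun h1 => ?_
    rw [h1] at hd
    simp at hd
  · exact aeval_modByMonic_eq_self_of_root (minpoly.aeval K x)

end

/-! ### Immediate extensions of valuation rings and the conclusion. -/

theorem IsImmediateExtension.isImmediateValuation {V K V' K' : Type*}
    [CommRing V] [IsDomain V] [ValuationRing V] [Field K] [Algebra V K] [IsFractionRing V K]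
    [CommRing V'] [IsDomain V'] [ValuationRing V'] [Field K'] [Algebra V' K']
    [IsFractionRing V' K'] [Algebra V V'] [Algebra K K'] [Algebra V K']
    [IsScalarTower V K K'] [IsScalarTower V V' K'] (hV : IsImmediateExtension V K V' K') :
    IsImmediateValuation V K (ValuationRing.valuation V' K') := by
  obtain ⟨e, he⟩ := hV.valueGroup
  have hloc := hV.isLocalHom
  have hle : ∀ z : K', ValuationRing.valuation V' K' z ≤ 1 ↔ ∃ a : V', algebraMap V' K' a = z :=
    fun z => ValuationRing.mem_integer_iff V' K' z
  have hex : ∀ z : K', ∃ c : K,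
      ValuationRing.valuation V' K' (algebraMap K K' c) = ValuationRing.valuation V' K' z := by
    intro z
    obtain ⟨c, hc⟩ := Quotient.exists_rep (e.symm (ValuationRing.valuation V' K' z))
    refine ⟨c, ?_⟩
    rw [← he, show ValuationRing.valuation V K c = _ from hc]
    exact e.apply_symm_apply _
  refine ⟨fun a => ?_, fun z _ => hex z, fun z hz => ?_⟩
  · rw [← he, ← map_one e, map_le_map_iff e]
    exact ValuationRing.mem_integer_iff V K a
  · obtain ⟨c, hc⟩ := hex z
    have hvz : ValuationRing.valuation V' K' z ≠ 0 := by simpa using hz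
    have hc0 : algebraMap K K' c ≠ 0 := by
      intro h
      rw [h, map_zero] at hc
      exact hvz hc.symm
    -- Equality of value groups writes `z = c a` with `a` of value `1`; equality of residue fields
    -- gives `t` in `V` with the residue of `a`, so `c t` approximates `z`.
    obtain ⟨a, ha⟩ := (hle (z / algebraMap K K' c)).mp (by rw [map_div₀, hc, div_self hvz])
    obtain ⟨t, ht⟩ := hV.residueField.2 (IsLocalRing.residue V' a)
    obtain ⟨t, rfl⟩ := IsLocalRing.residue_surjective t
    rw [IsLocalRing.ResidueField.map_residue] at ht
    have h1 : ¬ IsUnit (a - algebraMap V V' t) := by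
      rw [← mem_nonunits_iff, ← IsLocalRing.mem_maximalIdeal, ← IsLocalRing.residue_eq_zero_iff,
        map_sub, ht, sub_self]
    have h2 : ValuationRing.valuation V' K' (algebraMap V' K' (a - algebraMap V V' t)) < 1 := by
      refine lt_of_le_of_ne ((hle _).mpr ⟨_, rfl⟩) fun h3 => h1 ?_
      obtain ⟨d, hd⟩ := (hle (algebraMap V' K' (a - algebraMap V V' t))⁻¹).mp
        (by rw [map_inv₀, h3, inv_one])
      have h0 : algebraMap V' K' (a - algebraMap V V' t) ≠ 0 := fun h0 => by simp [h0] at h3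
      refine IsUnit.of_mul_eq_one d (IsFractionRing.injective V' K' ?_)
      rw [map_mul, hd, mul_inv_cancel₀ h0, map_one]
    refine ⟨c * algebraMap V K t, ?_⟩
    have h3 : z - algebraMap K K' (c * algebraMap V K t) =
        algebraMap K K' c * algebraMap V' K' (a - algebraMap V V' t) := by
      rw [map_sub, ha, map_mul, ← IsScalarTower.algebraMap_apply V K K',
        ← IsScalarTower.algebraMap_apply V V' K', mul_sub, mul_div_cancel₀ _ hc0]
    rw [h3, map_mul, hc]
    exact mul_lt_of_lt_one_right (zero_lt_iff.mpr hvz) h2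

/-- Two finitely generated members lie in any member containing both generating sets. -/
theorem isFilteredUnionOf_of_exists_le {A B : Type*} [CommRing A] [CommRing B] [Algebra A B]
    {Q : Subalgebra A B → Prop} (hfg : ∀ C, Q C → C.FG)
    (h : ∀ E : Finset B, ∃ C, Q C ∧ ∀ e ∈ E, e ∈ C) : IsFilteredUnionOf A B Q := by
  classical
  refine ⟨{C | Q C}, ?_, ?_, fun C hC => hC, fun b => ?_⟩
  · obtain ⟨C, hC, -⟩ := h ∅
    exact ⟨C, hC⟩
  · intro C hC D hD
    obtain ⟨s, rfl⟩ := hfg C hC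
    obtain ⟨t, rfl⟩ := hfg D hD
    obtain ⟨C', hC', hst⟩ := h (s ∪ t)
    exact ⟨C', hC', Algebra.adjoin_le fun e he => hst e (Finset.mem_union_left _ he),
      Algebra.adjoin_le fun e he => hst e (Finset.mem_union_right _ he)⟩
  · obtain ⟨C, hC, hb⟩ := h {b}
    exact ⟨C, hC, hb b (Finset.mem_singleton_self b)⟩

theorem IsCompleteIntersectionAlgebra.finiteType {A B : Type*} [CommRing A] [CommRing B]
    [Algebra A B] (hB : IsCompleteIntersectionAlgebra A B) : Algebra.FiniteType A B := by
  obtain ⟨n, h, P, φ, -, hφ, -, -⟩ := hB.exists_surjective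
  have h2 : Algebra.FiniteType A (Localization.Away h) := inferInstance
  exact h2.of_surjective φ hφ

theorem proposition2p3 {V K V' K' : Type*}
    [CommRing V] [IsDomain V] [ValuationRing V] [Field K] [Algebra V K] [IsFractionRing V K]
    [CommRing V'] [IsDomain V'] [ValuationRing V'] [Field K'] [Algebra V' K']
    [IsFractionRing V' K'] [Algebra V V'] [Algebra K K'] [Algebra V K']
    [IsScalarTower V K K'] [IsScalarTower V V' K']
    (hV : IsImmediateExtension V K V' K')
    (x : K') (hx : IsAlgebraic K x) (hK' : IntermediateField.adjoin K {x} = ⊤) :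
    IsFilteredUnionOf V V' (fun C => IsCompleteIntersectionAlgebra V C) := by
  classical
  have hv := hV.isImmediateValuation
  have hx' := hx.isIntegral
  have hsurj : Function.Surjective (aeval x : K[X] → K') := by
    intro e
    have h1 : e ∈ Algebra.adjoin K {x} := by
      rw [← IntermediateField.adjoin_simple_toSubalgebra_of_isAlgebraic hx, hK']
      trivial
    rw [Algebra.adjoin_singleton_eq_range_aeval] at h1
    exact h1
  -- The first chart `V[X]` requires a generator of value at most `1`; scaling by `c⁻¹` does not
  -- change the field generated.
  obtain ⟨c, hc0, hc⟩ : ∃ c : K, c ≠ 0 ∧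
      ValuationRing.valuation V' K' (algebraMap K K' c⁻¹ * x) ≤ 1 := by
    by_cases hx0 : x = 0
    · exact ⟨1, one_ne_zero, by simp [hx0]⟩
    · obtain ⟨c, hc⟩ := hv.exists_eq x hx0
      have hvx : ValuationRing.valuation V' K' x ≠ 0 := by simpa using hx0
      refine ⟨c, ?_, ?_⟩
      · rintro rfl
        rw [map_zero, map_zero] at hc
        exact hvx hc.symm
      · rw [map_mul, map_inv₀, map_inv₀, hc, inv_mul_cancel₀ hvx]
  have hsurj' : Function.Surjective (aeval (algebraMap K K' c⁻¹ * x) : K[X] → K') := by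
    intro e
    obtain ⟨p, rfl⟩ := hsurj e
    refine ⟨p.comp (C c * X), ?_⟩
    rw [aeval_comp, map_mul, aeval_C, aeval_X, ← mul_assoc, ← map_mul, mul_inv_cancel₀ hc0,
      map_one, one_mul]
  let j : V' →ₐ[V] K' := IsScalarTower.toAlgHom V V' K'
  have hj : Function.Injective j := IsFractionRing.injective V' K'
  refine isFilteredUnionOf_of_exists_le
    (fun C hC => C.fg_iff_finiteType.mpr hC.finiteType) fun E => ?_
  obtain ⟨D, hD, hD1, hED⟩ := hv.exists_subalgebra hc ((isIntegral_algebraMap).mul hx') hsurj'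
    (E.image j) (by
      intro e he
      obtain ⟨a, -, rfl⟩ := Finset.mem_image.mp he
      exact (ValuationRing.mem_integer_iff V' K' _).mpr ⟨a, rfl⟩)
  -- `D` has only integral values, so it is contained in the image of `V'` and can be pulled back
  -- isomorphically.
  have hmap : (D.comap j).map j = D := by
    refine le_antisymm (Subalgebra.map_le.mpr le_rfl) fun z hz => ?_
    obtain ⟨a, rfl⟩ := (ValuationRing.mem_integer_iff V' K' z).mp (hD1 z hz)
    exact ⟨a, hz, rfl⟩
  refine ⟨D.comap j, ?_, fun e he => hED _ (Finset.mem_image_of_mem j he)⟩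
  rw [← hmap] at hD
  exact hD.of_algEquiv ((D.comap j).equivMapOfInjective j hj).symm
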